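/- Let $0<a<b$ be coprime integers and put $\alpha=\frac ab\in\,]0,1[$. Let $\vec\Lambda\subset\mathbb C$ be a $\mathbb Z$-lattice (a discrete additive subgroup generating $\mathbb C$ as a real vector space), let $\operatorname{covol}_{\vec\Lambda}$ be its covolume, and let $\Lambda=z_0+\vec\Lambda$ (with $z_0\in\mathbb C$) be a $\mathbb Z$-grid with underlying lattice $\vec\Lambda$. Let $\phi,\psi$ be real functions on $\mathbb N$, positive at all $N\ge 1$ and both tending to $+\infty$, such that, for some $\lambda\in[0,+\infty]$, $$\frac{\phi(N)}{N^{1-\alpha}}\xrightarrow[N\to\infty]{}\lambda ,\qquad \psi(N)=\Big(\frac{N^{2-\alpha}}{\phi(N)}\Big)^2\quad\text{for all } N\ge 1 .$$ For non-negative integers $N,N',N''$ with $N\ge 1$ and $N'+N''\geq 1$ define the measure on $\mathbb C$ $$\mathcal R^{\alpha,\Lambda}_{N,N',N''}=\frac1{(N'+N'')\psi(N)}\sum_{\substack{m,n\in\Lambda,\ n\ne m\\ 0<|m|,|n|\le N}}\ \sum_{\substack{r\in\exp^{-1}(m),\ s\in\exp^{-1}(n)\\ |\operatorname{Im} r-\operatorname{Im}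 s|<2\pi\\ -2\pi N'\le \operatorname{Im} r,\,\operatorname{Im} s<2\pi N''}}\Delta_{\phi(N)(\exp(\alpha s)-\exp(\alpha r))},$$ where $\Delta_z$ is the unit Dirac mass at $z$. Let $\rho_{\alpha,\vec\Lambda,\lambda}:\mathbb C\to[0,+\infty[$ be the function $$\rho_{\alpha,\vec\Lambda,\lambda}(z)=\begin{cases}0&\text{if }\lambda=+\infty,\\[2mm] \dfrac{\pi}{\alpha^2(2-\alpha)\operatorname{covol}_{\vec\Lambda}^2}&\text{if }\lambda=0,\\[3mm] \dfrac{\alpha^{\frac2{1-\alpha}}}{(1-\alpha)\operatorname{covol}_{\vec\Lambda}}\Big(\dfrac{|z|}{\lambda}\Big)^{-\frac{4-2\alpha}{1-\alpha}}\displaystyle\sum_{\substack{p\in\vec\Lambda\\ |p|\le\frac{|z|}{\alpha\lambda}}}|p|^{\frac2{1-\alpha}}&\text{if }\lambda\in\,]0,+\infty[\end{cases}$$ (with value $0$ at $z=0$ in the last case). Then, as $N\to\infty$, the measures $\mathcal R^{a/b,\Lambda}_{N,0,b}$ (so with the fixed finite number $b$ of levels) converge vaguely to $\rho_{a/b,\vec\Lambda,\lambda}\operatorname{Leb}_{\mathbb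 C}$: these are Radon measures, and for every continuous $f:\mathbb C\to\mathbb C$ with compact support, $$\int_{\mathbb C} f\,d\mathcal R^{a/b,\Lambda}_{N,0,b}\xrightarrow[N\to\infty]{}\int_{\mathbb C} f(z)\,\rho_{a/b,\vec\Lambda,\lambda}(z)\,dz .$$ -/

import Mathlib

open MeasureTheory Filter Topology
open scoped ENNReal

noncomputable section

/-- `Λ` is a `ℤ`-grid with underlying lattice `L`: a translate `z + L` of `L`. -/
def IsZGrid (Λ : Set ℂ) (L : Submodule ℤ ℂ) : Prop :=
  ∃ z : ℂ, Λ = {w : ℂ | ∃ p ∈ L, w = z + p}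

/-- The pairs `(r, s)` of logarithms of distinct nonzero points `exp r ≠ exp s` of `Λ` of modulus
at most `N`, with `|Im r - Im s| < 2π` and `-2πN' ≤ Im r, Im s < 2πN''`.
(The points `exp r`, `exp s` are automatically nonzero.) -/
def logPairs (Λ : Set ℂ) (N N' N'' : ℕ) : Set (ℂ × ℂ) :=
  {x : ℂ × ℂ |
    Complex.exp x.1 ∈ Λ ∧ Complex.exp x.2 ∈ Λ ∧ Complex.exp x.2 ≠ Complex.exp x.1 ∧
    ‖Complex.exp x.1‖ ≤ (N : ℝ) ∧ ‖Complex.exp x.2‖ ≤ (N : ℝ) ∧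
    |x.1.im - x.2.im| < 2 * Real.pi ∧
    -(2 * Real.pi * (N' : ℝ)) ≤ x.1.im ∧ x.1.im < 2 * Real.pi * (N'' : ℝ) ∧
    -(2 * Real.pi * (N' : ℝ)) ≤ x.2.im ∧ x.2.im < 2 * Real.pi * (N'' : ℝ)}

/-- The empirical pair correlation measure with levels from `-N'` to `N'' - 1`:
`1 / ((N' + N'') ψ(N))` times the sum of the unit masses at `φ(N) (exp (α s) - exp (α r))`, over
all `(r, s)` in `logPairs Λ N N' N''`. -/
def pairCorrelationMeasure (α : ℝ) (Λ : Set ℂ) (φ ψ : ℕ → ℝ) (N N' N'' : ℕ) : Measure ℂ :=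
  ENNReal.ofReal (1 / (((N' : ℝ) + (N'' : ℝ)) * ψ N)) •
    Measure.sum (fun x : logPairs Λ N N' N'' =>
      Measure.dirac ((φ N : ℂ) *
        (Complex.exp ((α : ℂ) * x.1.2) - Complex.exp ((α : ℂ) * x.1.1))))

open Classical in
/-- The limit density `ρ_{α, L, lam}`. -/
def limitDensity (α : ℝ) (L : Submodule ℤ ℂ) (lam : ℝ≥0∞) (z : ℂ) : ℝ :=
  if lam = ⊤ then 0
  else if lam = 0 then Real.pi / (α ^ 2 * (2 - α) * ZLattice.covolume L ^ 2)
  else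
    α ^ (2 / (1 - α)) / ((1 - α) * ZLattice.covolume L) *
      (‖z‖ / lam.toReal) ^ (-((4 - 2 * α) / (1 - α))) *
      ∑ᶠ p ∈ {p : ℂ | p ∈ L ∧ ‖p‖ ≤ ‖z‖ / (α * lam.toReal)}, ‖p‖ ^ (2 / (1 - α))

/-- Vague convergence of a sequence of Radon (that is, finite on compact sets, Borel) measures on
`ℂ`, tested against complex valued continuous functions with compact support. -/
def VaguelyConverges (μ : ℕ → Measure ℂ) (ν : Measure ℂ) : Prop :=
  (∀ N, IsFiniteMeasureOnCompacts (μ N)) ∧ IsFiniteMeasureOnCompacts ν ∧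
    ∀ f : ℂ → ℂ, Continuous f → HasCompactSupport f →
      Tendsto (fun N => ∫ z, f z ∂(μ N)) atTop (𝓝 (∫ z, f z ∂ν))

end

/-!
Write `ℓ N = φ N / N ^ (1 - α)`, so that `ψ N = (N / ℓ N) ^ 2` and `ℓ N → lam`. For close logarithms
`r`, `s` of grid points `m`, `m + p` one has
`φ N (exp (α s) - exp (α r)) ≈ α (ℓ N p) (m / N) ^ (α - 1)`, where the power is taken on the branch
of `r`. The integral of a test function `f` is therefore a double Riemann sum: an outer sum over
the points `m / N` of a grid of spacing `N⁻¹` in the unit disc, and over the `b` branches, of inner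
sums over the points `ℓ N p` of a lattice of spacing `ℓ N`.

The error in the linearization, the pairs lost at the cut of the logarithm and those lost at the
boundary of the disc need no quantitative estimate. A lattice sum is the integral of a step function
(`ZLattice.integral_rounding`), so dominated convergence (`ZLattice.tendsto_scaled_tsum`) reduces
its asymptotics to the convergence of the summands along sequences of grid points converging to
almost every point, together with a uniform bound. This bound comes from two facts: powers
`exp (α r)`, `exp (α s)` can only be close if `r` and `s` are, because `|Im r - Im s| < 2π` and
`α < 1` (`exists_localization`), and a disc of radius `ρ` contains `O(ρ ^ 2)` nonzero lattice points
(`ZLattice.exists_scaled_tsum_bound`).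

The inner sum (`tendsto_level_sum`) becomes an integral if `lam = 0`, stays a lattice sum if `lam`
is positive and finite, and is eventually zero if `lam = ⊤`. The outer one (`tendsto_grid_sum`)
always becomes an integral over the disc. That integral is computed in polar coordinates. Along the
`b` branches, as `w` runs over a circle, `w ^ (a / b - 1)` sweeps its circle exactly `b - a` times,
which makes the limit rotation invariant (`sum_integral_periodic`, `integral_ball_sum_levels`), and
the radial substitution `y = C x ^ (α - 1)` yields the density (`integral_levelLimit_eq`).
-/

/-! ### Sums over a lattice as integrals of step functions -/

theorem ZLattice.finite_norm_le (L : Submodule ℤ ℂ) [DiscreteTopology L] (z : ℂ) (K : ℝ) :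
    {p : L | ‖z + p‖ ≤ K}.Finite := by
  have h1 : ((L : Set ℂ) ∩ Metric.closedBall (-z) K).Finite :=
    haveI : DiscreteTopology L.toAddSubgroup := ‹DiscreteTopology L›
    have hcl : IsClosed (L : Set ℂ) := AddSubgroup.isClosed_of_discrete (H := L.toAddSubgroup)
    (Metric.finite_isBounded_inter_isClosed (s := (L : Set ℂ)) (K := Metric.closedBall (-z) K)
      ⟨‹_›⟩ Metric.isBounded_closedBall hcl).subset (by rw [Set.inter_comm])
  refine (h1.preimage (f := ((↑) : L → ℂ)) Subtype.val_injective.injOn).subset fun p hp => ?_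
  refine ⟨p.2, ?_⟩
  rw [mem_closedBall_iff_norm, sub_neg_eq_add, add_comm]
  exact hp

theorem ZLattice.exists_norm_lower_bound (L : Submodule ℤ ℂ) [DiscreteTopology L] (z : ℂ) :
    ∃ δ : ℝ, 0 < δ ∧ ∀ p : L, z + p ≠ 0 → δ ≤ ‖z + (p : ℂ)‖ := by
  have hfin := ZLattice.finite_norm_le L z 1
  have h2 : ({p : L | ‖z + p‖ ≤ 1 ∧ z + p ≠ 0}).Finite := hfin.subset fun p hp => hp.1
  by_cases hne : ({p : L | ‖z + p‖ ≤ 1 ∧ z + p ≠ 0}).Nonempty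
  · obtain ⟨q, hq, hmin⟩ := h2.exists_minimalFor (fun p : L => ‖z + p‖) _ hne
    refine ⟨‖z + (q : ℂ)‖, norm_pos_iff.2 hq.2, fun p hp => ?_⟩
    by_cases h1 : ‖z + (p : ℂ)‖ ≤ 1
    · by_contra hlt
      exact hlt (hmin ⟨h1, hp⟩ (le_of_not_ge hlt))
    · exact hq.1.trans (le_of_not_ge h1)
  · refine ⟨1, one_pos, fun p hp => ?_⟩
    by_contra hlt
    exact hne ⟨p, le_of_not_ge hlt, hp⟩

/-- Rounding to a lattice: `q x` is the lattice point whose translate of a fixed bounded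
fundamental domain contains `x`. -/
theorem ZLattice.exists_rounding (L : Submodule ℤ ℂ) [DiscreteTopology L] [IsZLattice ℝ L] :
    ∃ (q : ℂ → L) (D : ℝ), 0 ≤ D ∧ (∀ x, ‖x - q x‖ ≤ D) ∧
      (∀ p : L, MeasurableSet (q ⁻¹' {p})) ∧
      ∀ p : L, volume (q ⁻¹' {p}) = ENNReal.ofReal (ZLattice.covolume L) := by
  have : Module.Free ℤ L := inferInstance
  let B := Module.Free.chooseBasis ℤ L
  let C := B.ofZLatticeBasis ℝ L
  have hC : Submodule.span ℤ (Set.range C) = L := B.ofZLatticeBasis_span ℝ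
  let q : ℂ → L := fun x => ⟨ZSpan.floor C x, hC.le (ZSpan.floor C x).2⟩
  have hq : ∀ x, x - (q x : ℂ) = ZSpan.fract C x := fun x => rfl
  have hpre : ∀ p : L, q ⁻¹' {p} = (fun x : ℂ => x - p) ⁻¹' (ZSpan.fundamentalDomain C) := by
    intro p
    ext x
    have hp : (p : ℂ) ∈ Submodule.span ℤ (Set.range C) := by rw [hC]; exact p.2
    simp only [Set.mem_preimage, Set.mem_singleton_iff]
    rw [← ZSpan.fract_eq_self]
    have h3 : ZSpan.fract C (x - p) = ZSpan.fract C x := by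
      have := ZSpan.fract_add_ZSpan C (x - p) hp
      rw [sub_add_cancel] at this
      exact this.symm
    rw [h3, ← hq]
    constructor
    · rintro rfl
      rfl
    · intro h
      exact Subtype.ext (sub_right_injective h)
  have hmeas := ZSpan.fundamentalDomain_measurableSet C
  refine ⟨q, ∑ i, ‖C i‖, by positivity, fun x => ?_, fun p => ?_, fun p => ?_⟩
  · rw [hq]
    exact ZSpan.norm_fract_le C x
  · rw [hpre]
    exact hmeas.preimage (measurable_id.sub_const _)
  · simp_rw [hpre, sub_eq_add_neg]
    rw [measure_preimage_add_right]
    have hfd := ZLattice.isAddFundamentalDomain B (volume : Measure ℂ)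
    rw [ZLattice.covolume_eq_measure_fundamentalDomain L volume hfd, measureReal_def,
      ENNReal.ofReal_toReal]
    exact (ZSpan.fundamentalDomain_isBounded C).measure_lt_top.ne

/-- A finitely supported sum over `L` is, up to the covolume and the scale, the integral over the
plane of the associated step function. -/
theorem ZLattice.integral_rounding (L : Submodule ℤ ℂ) [DiscreteTopology L] [IsZLattice ℝ L]
    {q : ℂ → L} (hqm : ∀ p : L, MeasurableSet (q ⁻¹' {p}))
    (hqv : ∀ p : L, volume (q ⁻¹' {p}) = ENNReal.ofReal (ZLattice.covolume L))
    (z : ℂ) {t : ℝ} (ht : 0 < t) (h : L → ℂ) (hh : (Function.support h).Finite) :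
    ∫ w : ℂ, h (q (t⁻¹ • w - z)) = t ^ 2 * (ZLattice.covolume L * ∑' p, h p) := by
  rw [Measure.integral_comp_smul volume (fun w => h (q (w - z))),
    integral_sub_right_eq_self (fun w => h (q w)), Complex.finrank_real_complex]
  have h1 : (fun w => h (q w)) = fun w => ∑ p ∈ hh.toFinset,
      (q ⁻¹' {p}).indicator (fun _ => h p) w := by
    ext w
    by_cases hw : h (q w) = 0
    · rw [hw, Finset.sum_eq_zero]
      intro p hp
      rw [Set.indicator_of_notMem]
      rintro rfl
      exact (by simpa using hp : h (q w) ≠ 0) hw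
    · rw [Finset.sum_eq_single (q w)]
      · rw [Set.indicator_of_mem]
        rfl
      · intro p _ hp
        rw [Set.indicator_of_notMem]
        rintro rfl
        exact hp rfl
      · intro h'
        exact absurd (by simpa using hw) h'
  rw [h1, integral_finsetSum]
  · simp_rw [integral_indicator (hqm _), setIntegral_const, measureReal_def, hqv,
      ENNReal.toReal_ofReal (ZLattice.covolume_pos L volume).le]
    rw [tsum_eq_sum (s := hh.toFinset) (by intro p hp; simpa using hp), ← Finset.smul_sum]
    rw [inv_pow, inv_inv, abs_of_nonneg (by positivity), Complex.real_smul, Complex.real_smul]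
    push_cast
    ring
  · intro p _
    rw [integrable_indicator_iff (hqm p)]
    refine integrableOn_const ?_
    rw [hqv]
    exact ENNReal.ofReal_ne_top

/-- The scaled rounding `w ↦ t (z + q (w / t - z))` to the grid `t (z + L)` moves points by
`O(t)`. -/
theorem norm_scaled_rounding_sub_le {L : Submodule ℤ ℂ} {q : ℂ → L} {D : ℝ}
    (hD : ∀ x, ‖x - q x‖ ≤ D) (z w : ℂ) {t : ℝ} (ht : 0 < t) :
    ‖w - (t : ℂ) * (z + q (t⁻¹ • w - z))‖ ≤ t * D := by
  have h6 := hD (t⁻¹ • w - z)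
  set p := q (t⁻¹ • w - z)
  have h7 : w - (t : ℂ) * (z + p) = (t : ℂ) * (t⁻¹ • w - z - p) := by
    have : (t : ℂ) ≠ 0 := by exact_mod_cast ht.ne'
    rw [Complex.real_smul]
    push_cast
    field_simp
    ring
  rw [h7, norm_mul, Complex.norm_real, Real.norm_of_nonneg ht.le]
  gcongr

/-- Riemann sums over the shrinking grids `t (z + L)`, with summands depending on the scale. The
pointwise hypothesis on the summands is only needed along sequences of grid points converging to
almost every point of the plane. -/
theorem ZLattice.tendsto_scaled_tsum (L : Submodule ℤ ℂ) [DiscreteTopology L] [IsZLattice ℝ L]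
    (z : ℂ) (t : ℕ → ℝ) (ht : ∀ᶠ N in atTop, 0 < t N) (ht0 : Tendsto t atTop (𝓝 0))
    (h : ℕ → L → ℂ) (C K : ℝ) (hb : ∀ᶠ N in atTop, ∀ p, ‖h N p‖ ≤ C)
    (hs : ∀ᶠ N in atTop, ∀ p, h N p ≠ 0 → ‖(t N : ℂ) * (z + p)‖ ≤ K)
    (G : ℂ → ℂ)
    (hG : ∀ᵐ w : ℂ, ∀ p : ℕ → L, Tendsto (fun N => (t N : ℂ) * (z + p N)) atTop (𝓝 w) →
      Tendsto (fun N => h N (p N)) atTop (𝓝 (G w))) :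
    Tendsto (fun N => (t N : ℂ) ^ 2 * ∑' p, h N p) atTop
      (𝓝 ((ZLattice.covolume L : ℂ)⁻¹ * ∫ w, G w)) := by
  obtain ⟨q, D, hD0, hD, hqm, hqv⟩ := ZLattice.exists_rounding L
  have hcov : (ZLattice.covolume L : ℂ) ≠ 0 := 
    Complex.ofReal_ne_zero.2 (ZLattice.covolume_ne_zero L volume)
  have hqmeas : @Measurable _ _ _ ⊤ q :=
    @measurable_to_countable' _ _ ⊤ _ _ q hqm
  have hlim : Tendsto (fun N => ∫ w : ℂ, h N (q ((t N)⁻¹ • w - z))) atTop (𝓝 (∫ w, G w)) := by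
    refine tendsto_integral_filter_of_dominated_convergence
      ((Metric.closedBall (0 : ℂ) (K + D)).indicator fun _ => C) ?_ ?_ ?_ ?_
    · refine Eventually.of_forall fun N => Measurable.aestronglyMeasurable ?_
      have : @Measurable _ _ ⊤ _ (h N) := fun s _ => trivial
      refine (this.comp hqmeas).comp (f := fun w : ℂ => (t N)⁻¹ • w - z) ?_
      fun_prop
    · filter_upwards [ht, hb, hs, ht0.eventually_le_const one_pos] with N h1 h2 h3 h4
      refine Eventually.of_forall fun w => ?_
      by_cases hw : h N (q ((t N)⁻¹ • w - z)) = 0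
      · rw [hw, norm_zero]
        exact Set.indicator_nonneg (fun _ _ => (norm_nonneg _).trans (h2 0)) _
      · rw [Set.indicator_of_mem]
        · exact h2 _
        · have h5 := h3 _ hw
          have h6 := norm_scaled_rounding_sub_le hD z w h1
          rw [mem_closedBall_zero_iff]
          have h7 := norm_le_norm_add_norm_sub' w ((t N : ℂ) * (z + q ((t N)⁻¹ • w - z)))
          have h8 : t N * D ≤ 1 * D := by gcongr
          linarith
    · rw [integrable_indicator_iff Metric.isClosed_closedBall.measurableSet]
      exact integrableOn_const measure_closedBall_lt_top.ne
    · filter_upwards [hG] with w hw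
      refine hw _ ?_
      rw [tendsto_iff_norm_sub_tendsto_zero]
      refine squeeze_zero' (Eventually.of_forall fun _ => norm_nonneg _)
        (g := fun N => t N * D) ?_ (by simpa using ht0.mul_const D)
      filter_upwards [ht] with N h1
      rw [norm_sub_rev]
      exact norm_scaled_rounding_sub_le hD z w h1
  have hsum := fun (N : ℕ) (h1 : 0 < t N) => ZLattice.integral_rounding L hqm hqv z h1 (h N)
  generalize ZLattice.covolume L = c at *
  refine (hlim.const_mul (c : ℂ)⁻¹).congr' ?_
  filter_upwards [ht, hs] with N h1 h3
  rw [hsum N h1]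
  · rw [mul_left_comm, inv_mul_cancel_left₀ hcov]
  · refine (ZLattice.finite_norm_le L z (K / t N)).subset fun p hp => ?_
    have := h3 p hp
    rw [norm_mul, Complex.norm_real, Real.norm_of_nonneg h1.le] at this
    rw [Set.mem_ofPred_eq, le_div_iff₀ h1]
    linarith

/-- There are `O((K / t) ^ 2)` nonzero lattice points of modulus at most `K / t`, uniformly in
all `t > 0`: small radii cause no trouble since the origin is left out. -/
theorem ZLattice.exists_scaled_tsum_bound (L : Submodule ℤ ℂ) [DiscreteTopology L]
    [IsZLattice ℝ L] :
    ∃ C : ℝ, 0 ≤ C ∧ ∀ (K t M : ℝ) (h : L → ℂ), 0 < t → 0 ≤ M → (∀ p, ‖h p‖ ≤ M) →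
      (∀ p, h p ≠ 0 → p ≠ 0 ∧ t * ‖(p : ℂ)‖ ≤ K) → t ^ 2 * ‖∑' p, h p‖ ≤ C * K ^ 2 * M := by
  obtain ⟨q, D, hD0, hD, hqm, hqv⟩ := ZLattice.exists_rounding L
  obtain ⟨δ, hδ, hmin⟩ := ZLattice.exists_norm_lower_bound L 0
  have hcov := ZLattice.covolume_pos L volume
  refine ⟨Real.pi * (1 + D / δ) ^ 2 / ZLattice.covolume L, by positivity, ?_⟩
  intro K t M h ht hM hb hs
  have hfin : {p : L | p ≠ 0 ∧ t * ‖(p : ℂ)‖ ≤ K}.Finite := by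
    refine (ZLattice.finite_norm_le L 0 (K / t)).subset fun p hp => ?_
    rw [Set.mem_ofPred_eq, le_div_iff₀ ht, zero_add, mul_comm]
    exact hp.2
  set S := hfin.toFinset with hS
  have hsum : ‖∑' p, h p‖ ≤ S.card * M := by
    rw [tsum_eq_sum (s := S)]
    · refine (norm_sum_le _ _).trans ?_
      refine (Finset.sum_le_sum fun p _ => hb p).trans ?_
      simp
    · intro p hp
      by_contra h0
      exact hp (by simpa [hS] using hs p h0)
  by_cases hemp : S = ∅
  · rw [hemp] at hsum
    have : ‖∑' p, h p‖ = 0 := le_antisymm (by simpa using hsum) (norm_nonneg _)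
    rw [this, mul_zero]
    positivity
  obtain ⟨p₀, hp₀⟩ := Finset.nonempty_iff_ne_empty.2 hemp
  have hp₀' : p₀ ≠ 0 ∧ t * ‖(p₀ : ℂ)‖ ≤ K := by simpa [hS] using hp₀
  have hKδ : δ ≤ K / t := by
    rw [le_div_iff₀ ht]
    have := hmin p₀ (by simpa using hp₀'.1)
    rw [zero_add] at this
    nlinarith
  have hcard : S.card * ZLattice.covolume L ≤ Real.pi * (K / t + D) ^ 2 := by
    have hKD : 0 ≤ K / t + D := by linarith
    have h1 : volume (⋃ p ∈ S, q ⁻¹' {p}) ≤ volume (Metric.closedBall (0 : ℂ) (K / t + D)) := by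
      refine measure_mono ?_
      intro x hx
      simp only [Set.mem_iUnion, Set.mem_preimage, Set.mem_singleton_iff] at hx
      obtain ⟨p, hp, rfl⟩ := hx
      have hp' : q x ≠ 0 ∧ t * ‖(q x : ℂ)‖ ≤ K := by simpa [hS] using hp
      have h2 : ‖(q x : ℂ)‖ ≤ K / t := by
        rw [le_div_iff₀ ht]
        linarith [hp'.2]
      rw [mem_closedBall_zero_iff]
      calc ‖x‖ = ‖(q x : ℂ) + (x - q x)‖ := by simp
        _ ≤ _ := (norm_add_le _ _).trans (add_le_add h2 (hD x))
    rw [measure_biUnion_finset _ (fun p _ => hqm p)] at h1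
    · simp_rw [hqv] at h1
      rw [Complex.volume_closedBall, Finset.sum_const, nsmul_eq_mul] at h1
      have h2 := ENNReal.toReal_mono (by finiteness) h1
      simp only [ENNReal.toReal_mul, ENNReal.toReal_natCast, ENNReal.toReal_pow,
        ENNReal.toReal_ofReal hcov.le, ENNReal.toReal_ofReal hKD, ENNReal.coe_toReal,
        NNReal.coe_real_pi] at h2
      linarith
    · intro p _ p' _ hpp
      refine Set.disjoint_left.2 fun x hx hx' => hpp ?_
      rw [← (hx : q x = p), (hx' : q x = p')]
  have hDK : D ≤ D / δ * (K / t) := by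
    calc D = D / δ * δ := by field_simp
      _ ≤ _ := by gcongr
  have hKt : 0 < K / t := hδ.trans_le hKδ
  have h3 : S.card * ZLattice.covolume L ≤ Real.pi * ((1 + D / δ) * (K / t)) ^ 2 := by
    refine hcard.trans ?_
    gcongr
    linarith
  have h4 : t ^ 2 * S.card ≤ Real.pi * (1 + D / δ) ^ 2 / ZLattice.covolume L * K ^ 2 := by
    rw [div_mul_eq_mul_div, le_div_iff₀ hcov]
    calc t ^ 2 * S.card * ZLattice.covolume L = t ^ 2 * (S.card * ZLattice.covolume L) := by ring
      _ ≤ t ^ 2 * (Real.pi * ((1 + D / δ) * (K / t)) ^ 2) := by gcongr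
      _ = Real.pi * (1 + D / δ) ^ 2 * K ^ 2 := by
        have := ht.ne'
        field_simp
  calc t ^ 2 * ‖∑' p, h p‖ ≤ t ^ 2 * (S.card * M) := by gcongr
    _ = t ^ 2 * S.card * M := by ring
    _ ≤ _ := by gcongr

/-! ### Branches of the logarithm -/

open Classical in
/-- The logarithm of `m ≠ 0` with imaginary part in `[2πk, 2π(k+1))`. Off the positive half-line
it is `log (-m) + πi + 2πik`, where `log` is the principal branch. -/
noncomputable def logBranch (k : ℕ) (m : ℂ) : ℂ :=
  (if -m ∈ Complex.slitPlane then Complex.log (-m) + Real.pi * Complex.I else Complex.log m) +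
    2 * Real.pi * k * Complex.I

theorem im_log_eq_zero_of_neg_notMem_slitPlane {m : ℂ} (h : -m ∉ Complex.slitPlane) :
    (Complex.log m).im = 0 := by
  rw [Complex.mem_slitPlane_iff, not_or, not_lt, not_not] at h
  simp only [Complex.neg_re, Complex.neg_im, neg_eq_zero] at h
  rw [Complex.log_im, Complex.arg_eq_zero_iff]
  exact ⟨by linarith [h.1], h.2⟩

theorem exp_logBranch (k : ℕ) {m : ℂ} (hm : m ≠ 0) : Complex.exp (logBranch k m) = m := by
  have h2 : Complex.exp (2 * Real.pi * k * Complex.I) = 1 :=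
    Complex.exp_eq_one_iff.2 ⟨k, by push_cast; ring⟩
  rw [logBranch, Complex.exp_add, h2, mul_one]
  split_ifs with h
  · rw [Complex.exp_add, Complex.exp_log (neg_ne_zero.2 hm), Complex.exp_pi_mul_I]
    ring
  · exact Complex.exp_log hm

theorem logBranch_im_mem (k : ℕ) (m : ℂ) :
    2 * Real.pi * k ≤ (logBranch k m).im ∧ (logBranch k m).im < 2 * Real.pi * (k + 1) ∧
      (-m ∈ Complex.slitPlane → 2 * Real.pi * k < (logBranch k m).im) := by
  have him : (2 * Real.pi * k * Complex.I : ℂ).im = 2 * Real.pi * k := by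
    have : (2 * Real.pi * k * Complex.I : ℂ) = ((2 * Real.pi * k : ℝ) : ℂ) * Complex.I := by
      push_cast
      ring
    rw [this, Complex.im_ofReal_mul, Complex.I_im, mul_one]
  rw [logBranch, Complex.add_im, him]
  by_cases h : -m ∈ Complex.slitPlane
  · have h1 := Complex.neg_pi_lt_log_im (-m)
    have h2 : (Complex.log (-m)).im < Real.pi := by
      refine lt_of_le_of_ne (Complex.log_im_le_pi _) ?_
      rw [Complex.log_im]
      exact Complex.slitPlane_arg_ne_pi h
    simp only [h, if_true, Complex.add_im, Complex.im_ofReal_mul, Complex.I_im, mul_one]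
    refine ⟨by linarith, by linarith, fun _ => by linarith⟩
  · simp only [h, if_false, im_log_eq_zero_of_neg_notMem_slitPlane h]
    refine ⟨by linarith, by linarith [Real.pi_pos], fun h' => h'.elim⟩

theorem exists_eq_logBranch {r : ℂ} {b : ℕ} (h0 : 0 ≤ r.im) (hb : r.im < 2 * Real.pi * b) :
    ∃ k < b, r = logBranch k (Complex.exp r) := by
  obtain ⟨n, hn⟩ := Complex.exp_eq_exp_iff_exists_int.1
    (exp_logBranch 0 (Complex.exp_ne_zero r)).symm
  have him : r.im = (logBranch 0 (Complex.exp r)).im + n * (2 * Real.pi) := by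
    conv_lhs => rw [hn]
    simp
  obtain ⟨h1, h2, -⟩ := logBranch_im_mem 0 (Complex.exp r)
  rw [Nat.cast_zero, mul_zero] at h1
  rw [Nat.cast_zero, zero_add, mul_one] at h2
  have hpi := Real.pi_pos
  have hn0 : 0 ≤ n := by
    by_contra hlt
    have : (n : ℝ) ≤ -1 := by exact_mod_cast (by omega : n ≤ -1)
    nlinarith
  lift n to ℕ using hn0
  refine ⟨n, ?_, ?_⟩
  · have h3 : (n : ℝ) * (2 * Real.pi) < b * (2 * Real.pi) := by
      push_cast at him
      linarith
    exact_mod_cast lt_of_mul_lt_mul_right h3 (by positivity)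
  · conv_lhs => rw [hn]
    simp only [logBranch]
    push_cast
    ring

theorem logBranch_injective (m : ℂ) : Function.Injective fun k => logBranch k m := by
  intro k k' h
  simp only [logBranch, add_right_inj] at h
  have h2 : (2 * Real.pi * Complex.I : ℂ) * k = 2 * Real.pi * Complex.I * k' := by
    linear_combination h
  exact_mod_cast mul_left_cancel₀ Complex.two_pi_I_ne_zero h2

theorem logBranch_ofReal_mul (k : ℕ) {t : ℝ} (ht : 0 < t) {m : ℂ} (hm : m ≠ 0) :
    logBranch k (t * m) = logBranch k m + Real.log t := by
  have h : -(t * m) ∈ Complex.slitPlane ↔ -m ∈ Complex.slitPlane := by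
    simp only [Complex.mem_slitPlane_iff, Complex.neg_re, Complex.neg_im, Complex.re_ofReal_mul,
      Complex.im_ofReal_mul, neg_ne_zero, mul_ne_zero_iff, ht.ne', not_false_iff, true_and, ne_eq]
    rw [← mul_neg, mul_pos_iff_of_pos_left ht]
  by_cases h' : -m ∈ Complex.slitPlane
  · simp only [logBranch, h.2 h', h', if_true]
    rw [← mul_neg, Complex.log_ofReal_mul ht (neg_ne_zero.2 hm)]
    ring
  · simp only [logBranch, mt h.1 h', h', if_false]
    rw [Complex.log_ofReal_mul ht hm]
    ring

theorem continuousAt_logBranch (k : ℕ) {w : ℂ} (hw : -w ∈ Complex.slitPlane) :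
    ContinuousAt (logBranch k) w := by
  have h1 : ContinuousAt (fun m : ℂ => Complex.log (-m) + Real.pi * Complex.I +
      2 * Real.pi * k * Complex.I) w :=
    (((continuousAt_clog hw).comp (f := fun m : ℂ => -m) continuous_neg.continuousAt).add
      continuousAt_const).add continuousAt_const
  refine h1.congr ?_
  filter_upwards [continuous_neg.continuousAt.preimage_mem_nhds
    (Complex.isOpen_slitPlane.mem_nhds hw)] with m hm
  rw [logBranch, if_pos (show -m ∈ Complex.slitPlane from hm)]

theorem logBranch_neg (k : ℕ) {w : ℂ} (hw : w ∈ Complex.slitPlane) :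
    logBranch k (-w) = Complex.log w + Real.pi * Complex.I + 2 * Real.pi * k * Complex.I := by
  rw [logBranch, neg_neg, if_pos hw]

theorem norm_exp_ofReal_mul (α : ℝ) (r : ℂ) :
    ‖Complex.exp (α * r)‖ = ‖Complex.exp r‖ ^ α := by
  rw [Complex.norm_exp, Complex.norm_exp, Complex.re_ofReal_mul, ← Real.exp_mul, mul_comm]

/-! ### Separation of the powers -/

/-- Within an open strip of width less than `2π`, as swept by `α d` when `|Im d| < 2π` and `α < 1`,
the only zero of `exp - 1` is the origin, and it is simple. -/
theorem exists_norm_le_mul_norm_exp_sub_one {α : ℝ} (h0 : 0 < α) (h1 : α < 1) :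
    ∃ ε : ℝ, 0 < ε ∧ ∀ d : ℂ, |d.im| < 2 * Real.pi → ‖Complex.exp (α * d) - 1‖ ≤ ε →
      ‖d‖ ≤ 2 / α * ‖Complex.exp (α * d) - 1‖ := by
  refine ⟨min (1 / 2) (1 - α), lt_min (by norm_num) (by linarith), fun d hd hε => ?_⟩
  set z := Complex.exp (α * d) - 1 with hz
  have hz1 := Complex.norm_log_one_add_half_le_self (hε.trans (min_le_left _ _))
  have hz2 : ‖z‖ ≤ 1 - α := hε.trans (min_le_right _ _)
  have hexp : Complex.exp (α * d) = Complex.exp (Complex.log (1 + z)) := by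
    rw [hz, add_sub_cancel, Complex.exp_log (Complex.exp_ne_zero _)]
  -- `α d` and `log (1 + z)` differ by `2πin`, and `|Im (α d)| < 2πα` forces `n = 0`.
  obtain ⟨n, hn⟩ := Complex.exp_eq_exp_iff_exists_int.1 hexp
  have him : α * d.im = (Complex.log (1 + z)).im + n * (2 * Real.pi) := by
    have := congrArg Complex.im hn
    simpa using this
  have hl := (Complex.abs_im_le_norm (Complex.log (1 + z))).trans hz1
  have hpi := Real.pi_gt_three
  have hn0 : n = 0 := by
    rw [abs_le] at hl
    rw [abs_lt] at hd
    have h2 : α * d.im < α * (2 * Real.pi) := by gcongr; exact hd.2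
    have h3 : α * -(2 * Real.pi) < α * d.im := by gcongr; exact hd.1
    have h4 : (n : ℝ) < 1 := by nlinarith
    have h5 : (-1 : ℝ) < n := by nlinarith
    have h4' : n < 1 := by exact_mod_cast h4
    have h5' : -1 < n := by exact_mod_cast h5
    omega
  rw [hn0, Int.cast_zero, zero_mul, add_zero] at hn
  have hd' : α * ‖d‖ = ‖Complex.log (1 + z)‖ := by
    rw [← hn, norm_mul, Complex.norm_real, Real.norm_of_nonneg h0.le]
  rw [div_mul_eq_mul_div, le_div_iff₀ h0, mul_comm, hd']
  linarith [norm_nonneg z]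

/-- Close pairs of powers come from close logarithms: if `φ |exp (α (r + d)) - exp (α r)| ≤ R`
with `φ` large, then `d` is small, and the difference `exp (r + d) - exp r` of the original points
is `O(N ^ (1 - α) / φ)`. -/
theorem exists_localization {α : ℝ} (h0 : 0 < α) (h1 : α < 1) {δ R : ℝ} (hδ : 0 < δ)
    (hR : 0 ≤ R) :
    ∃ T K : ℝ, 0 < T ∧ 0 ≤ K ∧ ∀ (φ N : ℝ) (r d : ℂ), T ≤ φ → 0 < N → δ ≤ ‖Complex.exp r‖ →
      ‖Complex.exp r‖ ≤ N → |d.im| < 2 * Real.pi →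
      ‖(φ : ℂ) * (Complex.exp (α * (r + d)) - Complex.exp (α * r))‖ ≤ R →
      ‖d‖ ≤ 1 / 4 ∧ φ / N ^ (1 - α) * ‖Complex.exp r * (Complex.exp d - 1)‖ ≤ K := by
  obtain ⟨ε, hε, hsep⟩ := exists_norm_le_mul_norm_exp_sub_one h0 h1
  set η := min ε (α / 8) with hη
  have hη0 : 0 < η := lt_min hε (by positivity)
  have hδα : 0 < δ ^ α := Real.rpow_pos_of_pos hδ _
  -- `T` makes `‖exp (α d) - 1‖ ≤ R / (φ δ ^ α)` at most `η`; the bound `α / 8` in `η` gives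
  -- `‖d‖ ≤ 1 / 4`, hence `‖exp d - 1‖ ≤ 1 / 2`.
  refine ⟨R / (δ ^ α * η) + 1, 4 * R / α, by positivity, by positivity, ?_⟩
  intro φ N r d hT hN hδr hrN hd hle
  have hφ : 0 < φ := lt_of_lt_of_le (by positivity) hT
  set m := ‖Complex.exp r‖ with hm
  have hm0 : 0 < m := hδ.trans_le hδr
  have hfac : Complex.exp (α * (r + d)) - Complex.exp (α * r) =
      Complex.exp (α * r) * (Complex.exp (α * d) - 1) := by
    rw [mul_add, Complex.exp_add]
    ring
  rw [hfac, norm_mul, norm_mul, norm_exp_ofReal_mul, Complex.norm_real,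
    Real.norm_of_nonneg hφ.le, ← hm] at hle
  set e := ‖Complex.exp (α * d) - 1‖ with he
  have he0 : 0 ≤ e := norm_nonneg _
  have heη : e ≤ η := by
    have h2 : R / (δ ^ α * η) ≤ φ := by linarith
    rw [div_le_iff₀ (by positivity)] at h2
    have h3 : δ ^ α ≤ m ^ α := Real.rpow_le_rpow hδ.le hδr h0.le
    have h4 : φ * δ ^ α * e ≤ φ * δ ^ α * η := by
      calc φ * δ ^ α * e ≤ φ * (m ^ α * e) := by
            rw [mul_assoc]
            gcongr
        _ ≤ R := hle
        _ ≤ _ := by linarith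
    exact le_of_mul_le_mul_left h4 (by positivity)
  have hd1 : ‖d‖ ≤ 2 / α * e := hsep d hd (heη.trans (min_le_left _ _))
  have hd2 : ‖d‖ ≤ 1 / 4 := by
    refine hd1.trans ?_
    calc 2 / α * e ≤ 2 / α * (α / 8) := by
          gcongr
          exact heη.trans (min_le_right _ _)
      _ = 1 / 4 := by
          field_simp
          norm_num
  refine ⟨hd2, ?_⟩
  have hd3 : ‖Complex.exp d - 1‖ ≤ 4 / α * e := by
    refine (Complex.norm_exp_sub_one_le (by linarith)).trans ?_
    calc 2 * ‖d‖ ≤ 2 * (2 / α * e) := by gcongr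
      _ = _ := by ring
  have hNα : 0 < N ^ (1 - α) := Real.rpow_pos_of_pos hN _
  have hmN : m ^ (1 - α) ≤ N ^ (1 - α) := Real.rpow_le_rpow hm0.le hrN (by linarith)
  have hmm : m = m ^ (1 - α) * m ^ α := by
    rw [← Real.rpow_add hm0]
    simp
  rw [norm_mul, ← hm]
  calc φ / N ^ (1 - α) * (m * ‖Complex.exp d - 1‖)
      ≤ φ / N ^ (1 - α) * (m * (4 / α * e)) := by gcongr
    _ = (m ^ (1 - α) / N ^ (1 - α)) * (4 / α) * (φ * (m ^ α * e)) := by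
        conv_lhs => rw [hmm]
        ring
    _ ≤ 1 * (4 / α) * R := by
        gcongr
        rwa [div_le_one hNα]
    _ = _ := by ring

/-! ### Reindexing the pairs of logarithms -/

open Classical in
/-- The contribution of the pair `(r, s)` to the integral of `f`, where `s` is the logarithm of
`exp r + p` closest to `r`. It vanishes when the pair is not admissible, and also when `p` is
not small compared with `exp r`. -/
noncomputable def pairTerm (f : ℂ → ℂ) (α φ : ℝ) (N b : ℕ) (r p : ℂ) : ℂ :=
  if p ≠ 0 ∧ ‖p‖ ≤ ‖Complex.exp r‖ / 2 ∧ ‖Complex.exp r + p‖ ≤ N ∧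
      0 ≤ (r + Complex.log (1 + p / Complex.exp r)).im ∧
      (r + Complex.log (1 + p / Complex.exp r)).im < 2 * Real.pi * b
  then f (φ * (Complex.exp (α * (r + Complex.log (1 + p / Complex.exp r))) -
    Complex.exp (α * r)))
  else 0

open Classical in
/-- `pairTerm` at the `k`-th logarithm of `m`, restricted to `0 < ‖m‖ ≤ N`. -/
noncomputable def levelTerm (f : ℂ → ℂ) (α φ : ℝ) (N b : ℕ) (m : ℂ) (k : ℕ) (p : ℂ) : ℂ :=
  if m ≠ 0 ∧ ‖m‖ ≤ N then pairTerm f α φ N b (logBranch k m) p else 0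

theorem exp_add_log_one_add_div {r p : ℂ} (hp : ‖p‖ ≤ ‖Complex.exp r‖ / 2) :
    Complex.exp (r + Complex.log (1 + p / Complex.exp r)) = Complex.exp r + p := by
  have hr := Complex.exp_ne_zero r
  have hr' := norm_pos_iff.2 hr
  have h : 1 + p / Complex.exp r ≠ 0 := by
    intro h
    have h2 : p = -Complex.exp r := by
      field_simp at h
      linear_combination h
    rw [h2, norm_neg] at hp
    linarith
  rw [Complex.exp_add, Complex.exp_log h]
  field_simp

/-- The terms which do not vanish are localized: `φ |p| = O(N ^ (1 - α))`. -/
theorem exists_levelTerm_support {α : ℝ} (h0 : 0 < α) (h1 : α < 1) {δ R : ℝ} (hδ : 0 < δ)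
    (hR : 0 ≤ R) {f : ℂ → ℂ} (hf : ∀ w, f w ≠ 0 → ‖w‖ ≤ R) :
    ∃ T K : ℝ, 0 < T ∧ 0 ≤ K ∧ ∀ (φ : ℝ) (N b : ℕ) (m : ℂ) (k : ℕ) (p : ℂ), T ≤ φ → 0 < N →
      (m ≠ 0 → δ ≤ ‖m‖) → levelTerm f α φ N b m k p ≠ 0 →
      (m ≠ 0 ∧ ‖m‖ ≤ N) ∧ p ≠ 0 ∧ φ / (N : ℝ) ^ (1 - α) * ‖p‖ ≤ K := by
  obtain ⟨T, K, hT, hK, hloc⟩ := exists_localization h0 h1 hδ hR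
  refine ⟨T, K, hT, hK, fun φ N b m k p hφ hN hm hne => ?_⟩
  rw [levelTerm] at hne
  split_ifs at hne with hm'
  · rw [pairTerm] at hne
    split_ifs at hne with hp
    · refine ⟨hm', hp.1, ?_⟩
      have hex := exp_add_log_one_add_div hp.2.1
      have hr : Complex.exp (logBranch k m) = m := exp_logBranch k hm'.1
      have him : |(Complex.log (1 + p / Complex.exp (logBranch k m))).im| < 2 * Real.pi := by
        have := Complex.abs_arg_le_pi (1 + p / Complex.exp (logBranch k m))
        rw [Complex.log_im]
        linarith [Real.pi_pos]
      have h2 := (hloc φ N (logBranch k m) _ hφ (by exact_mod_cast hN) (by rw [hr]; exact hm hm'.1)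
        (by rw [hr]; exact hm'.2) him (hf _ hne)).2
      have h3 : Complex.exp (logBranch k m) *
          (Complex.exp (Complex.log (1 + p / Complex.exp (logBranch k m))) - 1) = p := by
        rw [mul_sub, ← Complex.exp_add, hex]
        ring
      rwa [h3] at h2
    · exact absurd rfl hne
  · exact absurd rfl hne

/-- For large `φ` the sum over the pairs of logarithms can be reindexed by the grid point `exp r`,
the level `k` of `r` and the difference `p = exp s - exp r`: by localization, the pairs that matter
have `s` so close to `r` that `p` determines it. -/
theorem exists_tsum_logPairs_eq {α : ℝ} (h0 : 0 < α) (h1 : α < 1)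
    (L : Submodule ℤ ℂ) [DiscreteTopology L] (z : ℂ) {R : ℝ} (hR : 0 ≤ R) {f : ℂ → ℂ}
    (hf : ∀ w, f w ≠ 0 → ‖w‖ ≤ R) :
    ∃ T : ℝ, ∀ (φ : ℝ) (N b : ℕ), T ≤ φ → 0 < N →
      ∑' x : logPairs {w : ℂ | ∃ p ∈ L, w = z + p} N 0 b,
        f (φ * (Complex.exp (α * x.1.2) - Complex.exp (α * x.1.1))) =
      ∑' y : L × (Fin b × L), levelTerm f α φ N b (z + y.1) y.2.1 y.2.2 := by
  obtain ⟨δ, hδ, hmin⟩ := ZLattice.exists_norm_lower_bound L z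
  obtain ⟨T, K, hT, hK, hloc⟩ := exists_localization h0 h1 hδ hR
  refine ⟨T, fun φ N b hφ hN => ?_⟩
  set g : L × (Fin b × L) → ℂ := fun y => levelTerm f α φ N b (z + y.1) y.2.1 y.2.2 with hg
  have hcond : ∀ y : Function.support g, ((z + (y.1.1 : ℂ)) ≠ 0 ∧ ‖z + (y.1.1 : ℂ)‖ ≤ N) ∧
      (let r := logBranch y.1.2.1 (z + y.1.1)
       let p : ℂ := y.1.2.2
       p ≠ 0 ∧ ‖p‖ ≤ ‖Complex.exp r‖ / 2 ∧ ‖Complex.exp r + p‖ ≤ N ∧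
      0 ≤ (r + Complex.log (1 + p / Complex.exp r)).im ∧
      (r + Complex.log (1 + p / Complex.exp r)).im < 2 * Real.pi * b) := by
    intro y
    have hne : levelTerm f α φ N b (z + y.1.1) y.1.2.1 y.1.2.2 ≠ 0 := y.2
    rw [levelTerm] at hne
    split_ifs at hne with hm'
    · rw [pairTerm] at hne
      split_ifs at hne with hp
      · exact ⟨hm', hp⟩
      · exact absurd rfl hne
    · exact absurd rfl hne
  let i : Function.support g → ℂ × ℂ := fun y =>
    (logBranch y.1.2.1 (z + y.1.1), logBranch y.1.2.1 (z + y.1.1) +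
      Complex.log (1 + y.1.2.2 / Complex.exp (logBranch y.1.2.1 (z + y.1.1))))
  have hi1 : ∀ y, Complex.exp (i y).1 = z + y.1.1 := fun y => exp_logBranch _ (hcond y).1.1
  have hi2 : ∀ y, Complex.exp (i y).2 = z + y.1.1 + y.1.2.2 := by
    intro y
    rw [← hi1]
    exact exp_add_log_one_add_div (hcond y).2.2.1
  have hi : ∀ y, i y ∈ logPairs {w : ℂ | ∃ p ∈ L, w = z + p} N 0 b := by
    intro y
    obtain ⟨⟨c1, c2⟩, c3, c4, c5, c6, c7⟩ := hcond y
    obtain ⟨l1, l2, -⟩ := logBranch_im_mem y.1.2.1 (z + y.1.1)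
    have hk : ((y.1.2.1 : ℕ) : ℝ) + 1 ≤ b := by exact_mod_cast y.1.2.1.2
    refine ⟨?_, ?_, ?_, ?_, ?_, ?_, ?_, ?_, ?_, ?_⟩
    · rw [hi1]
      exact ⟨_, y.1.1.2, rfl⟩
    · rw [hi2]
      exact ⟨_, L.add_mem y.1.1.2 y.1.2.2.2, by rw [add_assoc]⟩
    · rw [hi1, hi2]
      simpa using c3
    · rwa [hi1]
    · rw [hi2]
      rwa [exp_logBranch _ c1] at c5
    · have : (i y).1.im - (i y).2.im =
          -(Complex.log (1 + y.1.2.2 / Complex.exp (logBranch y.1.2.1 (z + y.1.1)))).im := by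
        simp [i]
      rw [this, abs_neg, Complex.log_im]
      linarith [Complex.abs_arg_le_pi
        (1 + y.1.2.2 / Complex.exp (logBranch y.1.2.1 (z + y.1.1))), Real.pi_pos]
    · simp only [Nat.cast_zero, mul_zero, neg_zero]
      exact le_trans (by positivity) l1
    · refine l2.trans_le ?_
      gcongr
    · simpa only [Nat.cast_zero, mul_zero, neg_zero] using c6
    · exact c7
  refine tsum_eq_tsum_of_ne_zero_bij (fun y => ⟨i y, hi y⟩) ?_ ?_ ?_
  · intro y y' hyy
    have h2 : i y = i y' := congrArg Subtype.val hyy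
    have e1 : y.1.1 = y'.1.1 := by
      have := hi1 y
      rw [h2, hi1] at this
      exact Subtype.ext (add_left_cancel this).symm
    have e2 : y.1.2.2 = y'.1.2.2 := by
      have := hi2 y
      rw [h2, hi2, e1] at this
      exact Subtype.ext (add_left_cancel this).symm
    have e3 : y.1.2.1 = y'.1.2.1 := by
      have h3 : (i y).1 = (i y').1 := by rw [h2]
      have h4 : logBranch y.1.2.1 (z + y.1.1) = logBranch y'.1.2.1 (z + y'.1.1) := h3
      rw [e1] at h4
      exact Fin.ext (logBranch_injective _ h4)
    exact Subtype.ext (Prod.ext e1 (Prod.ext e3 e2))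
  · rintro ⟨⟨r, s⟩, ⟨p, hp, hrp⟩, ⟨p', hp', hsp⟩, hne, hrN, hsN, him, him1, him2, him3, him4⟩ hx
    simp only [Function.mem_support] at hx hrp hsp hne hrN hsN him him1 him2 him3 him4
    simp only [Nat.cast_zero, mul_zero, neg_zero] at him1 him3
    obtain ⟨k, hkb, hrk⟩ := exists_eq_logBranch him1 him2
    have hd := hloc φ N r (s - r) hφ (by exact_mod_cast hN)
      (by rw [hrp]
          exact hmin ⟨p, hp⟩ (by rw [← hrp]; exact Complex.exp_ne_zero r)) hrN
      (by rw [Complex.sub_im, abs_sub_comm]; exact him)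
      (by rw [add_sub_cancel]; exact hf _ hx)
    have hexp : 1 + (p' - p) / Complex.exp r = Complex.exp (s - r) := by
      have h2 : p' - p = Complex.exp s - Complex.exp r := by
        rw [hrp, hsp]
        ring
      rw [h2, Complex.exp_sub]
      field_simp
      ring
    have hlog : Complex.log (1 + (p' - p) / Complex.exp r) = s - r := by
      have h2 := (abs_le.1 ((Complex.abs_im_le_norm (s - r)).trans hd.1))
      have h3 := Real.pi_gt_three
      rw [hexp, Complex.log_exp (by linarith [h2.1]) (by linarith [h2.2])]
    have hkr : logBranch k (z + p) = r := by
      rw [← hrp]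
      exact hrk.symm
    have hg1 : g (⟨p, hp⟩, (⟨k, hkb⟩, ⟨p' - p, L.sub_mem hp' hp⟩)) =
        f (φ * (Complex.exp (α * s) - Complex.exp (α * r))) := by
      simp only [hg, levelTerm]
      rw [if_pos ⟨by rw [← hrp]; exact Complex.exp_ne_zero r, by rwa [← hrp]⟩]
      simp only [hkr, pairTerm]
      have hadd : Complex.exp r + (p' - p) = Complex.exp s := by
        rw [hrp, hsp]
        ring
      rw [if_pos, hlog, add_sub_cancel]
      rw [hlog, add_sub_cancel]
      refine ⟨?_, ?_, by rwa [hadd], him3, him4⟩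
      · intro h
        rw [h, add_zero] at hadd
        exact hne hadd.symm
      · have h2 : p' - p = Complex.exp r * (Complex.exp (s - r) - 1) := by
          rw [← hexp]
          field_simp
          ring
        have h3 := Complex.norm_exp_sub_one_le (x := s - r) (by linarith [hd.1])
        rw [h2, norm_mul]
        have h4 : ‖Complex.exp (s - r) - 1‖ ≤ 1 / 2 := by linarith [hd.1]
        nlinarith [norm_nonneg (Complex.exp r)]
    refine ⟨⟨(⟨p, hp⟩, (⟨k, hkb⟩, ⟨p' - p, L.sub_mem hp' hp⟩)), ?_⟩, ?_⟩
    · exact fun h0 => hx (hg1.symm.trans h0)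
    · refine Subtype.ext (Prod.ext hkr ?_)
      simp only [i, hkr, hlog, add_sub_cancel]
  · intro y
    have h2 := hcond y
    change _ = levelTerm f α φ N b (z + y.1.1) y.1.2.1 y.1.2.2
    rw [levelTerm, if_pos h2.1, pairTerm, if_pos h2.2]

/-! ### Limits of the contributions of a single logarithm -/

/-- The linearization: if `m N / N → w` and `ℓ N p N → v`, where `ℓ N = φ N / N ^ (1 - α)`, then
`φ N (exp (α s) - exp (α r)) → α w ^ (α - 1) v`, the power being taken on the branch `k`. As `w`
lies off the cut and inside the disc, and `v ≠ 0`, the pair is eventually admissible. -/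
theorem tendsto_levelTerm {α : ℝ} (h0 : 0 < α) {f : ℂ → ℂ} (hf : Continuous f) {φ : ℕ → ℝ}
    (hφ : Tendsto φ atTop atTop) {b k : ℕ} (hk : k < b) {w v : ℂ} (hw1 : ‖w‖ < 1)
    (hw : -w ∈ Complex.slitPlane) (hv : v ≠ 0) {m p : ℕ → ℂ}
    (hm : Tendsto (fun N : ℕ => ((N : ℝ)⁻¹ : ℝ) * m N) atTop (𝓝 w))
    (hp : Tendsto (fun N : ℕ => ((φ N / (N : ℝ) ^ (1 - α) : ℝ) : ℂ) * p N) atTop (𝓝 v)) :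
    Tendsto (fun N => levelTerm f α (φ N) N b (m N) k (p N)) atTop
      (𝓝 (f (α * Complex.exp (((α - 1 : ℝ) : ℂ) * logBranch k w) * v))) := by
  have hw0 : w ≠ 0 := neg_ne_zero.1 (Complex.slitPlane_ne_zero hw)
  set ℓ : ℕ → ℝ := fun N => φ N / (N : ℝ) ^ (1 - α) with hℓ
  have hN0 : ∀ᶠ N : ℕ in atTop, 0 < (N : ℝ) := by
    filter_upwards [eventually_gt_atTop 0] with N hN
    exact_mod_cast hN
  -- `ℓ N * N = φ N * N ^ α` tends to infinity, so that `p N = o(N)`.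
  have hpN : Tendsto (fun N : ℕ => ((N : ℝ)⁻¹ : ℝ) * p N) atTop (𝓝 0) := by
    have h1 : Tendsto (fun N : ℕ => (φ N * (N : ℝ) ^ α)⁻¹) atTop (𝓝 0) :=
      tendsto_inv_atTop_zero.comp (hφ.atTop_mul_atTop₀
        ((tendsto_rpow_atTop h0).comp tendsto_natCast_atTop_atTop))
    have h2 := ((Complex.continuous_ofReal.tendsto 0).comp h1).mul hp
    rw [Complex.ofReal_zero, zero_mul] at h2
    refine h2.congr' ?_
    filter_upwards [hN0, hφ.eventually_gt_atTop 0] with N h3 h4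
    have h5 : (N : ℝ)⁻¹ = (φ N * (N : ℝ) ^ α)⁻¹ * (φ N / (N : ℝ) ^ (1 - α)) := by
      have h6 : (N : ℝ) = (N : ℝ) ^ α * (N : ℝ) ^ (1 - α) := by
        rw [← Real.rpow_add h3]
        simp
      have h7 := (Real.rpow_pos_of_pos h3 α).ne'
      have h8 := (Real.rpow_pos_of_pos h3 (1 - α)).ne'
      have h9 := h4.ne'
      conv_lhs => rw [h6]
      field_simp
    rw [h5, Complex.ofReal_mul]
    simp only [Function.comp_apply]
    ring
  have hx : Tendsto (fun N => p N / m N) atTop (𝓝 0) := by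
    have h1 := hpN.div hm hw0
    rw [zero_div] at h1
    refine h1.congr' ?_
    filter_upwards [hN0] with N h3
    have : (((N : ℝ)⁻¹ : ℝ) : ℂ) ≠ 0 := by
      exact_mod_cast (inv_pos.2 h3).ne'
    simp only [Pi.div_apply]
    rw [mul_div_mul_left _ _ this]
  have hlogb : Tendsto (fun N : ℕ => logBranch k (((N : ℝ)⁻¹ : ℝ) * m N)) atTop
      (𝓝 (logBranch k w)) := (continuousAt_logBranch k hw).tendsto.comp hm
  have hmne : ∀ᶠ N in atTop, m N ≠ 0 := by
    filter_upwards [hm.eventually_ne hw0] with N h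
    exact right_ne_zero_of_mul h
  have hrN : ∀ᶠ N : ℕ in atTop, logBranch k (m N) =
      logBranch k (((N : ℝ)⁻¹ : ℝ) * m N) + Real.log N := by
    filter_upwards [hN0, hmne] with N h3 h4
    rw [logBranch_ofReal_mul k (inv_pos.2 h3) h4, Real.log_inv]
    push_cast
    ring
  have hlog1 : Tendsto (fun N => Complex.log (1 + p N / m N)) atTop (𝓝 0) := by
    have h1 : ContinuousAt (fun x : ℂ => Complex.log (1 + x)) 0 := by
      refine ContinuousAt.clog (by fun_prop) ?_
      simp
    have h2 := h1.tendsto.comp hx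
    simpa [Function.comp_def] using h2
  -- The power function near `1`, through its difference quotient.
  let P : ℂ → ℂ := fun x => Complex.exp (α * Complex.log (1 + x))
  have hP : HasDerivAt P α 0 := by
    have h1 : HasDerivAt (fun x : ℂ => 1 + x) 1 0 := (hasDerivAt_id 0).const_add 1
    have h2 := ((h1.clog (by simp)).const_mul (α : ℂ)).cexp
    simpa [P] using h2
  have hslope : Tendsto (fun N => dslope P 0 (p N / m N)) atTop (𝓝 (α : ℂ)) := by
    have h1 : ContinuousAt (dslope P 0) 0 := continuousAt_dslope_same.2 hP.differentiableAt
    have h2 := h1.tendsto.comp hx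
    rwa [dslope_same, hP.deriv] at h2
  have hval : Tendsto (fun N : ℕ => (((ℓ N : ℝ) : ℂ) * p N) *
      Complex.exp (((α - 1 : ℝ) : ℂ) * logBranch k (((N : ℝ)⁻¹ : ℝ) * m N)) *
      dslope P 0 (p N / m N)) atTop
      (𝓝 (v * Complex.exp (((α - 1 : ℝ) : ℂ) * logBranch k w) * α)) :=
    (hp.mul ((Complex.continuous_exp.tendsto _).comp (hlogb.const_mul _))).mul hslope
  have hval2 := (hf.tendsto _).comp hval
  have hcomm : v * Complex.exp (((α - 1 : ℝ) : ℂ) * logBranch k w) * α =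
      α * Complex.exp (((α - 1 : ℝ) : ℂ) * logBranch k w) * v := by ring
  rw [hcomm] at hval2
  refine hval2.congr' ?_
  have hpne : ∀ᶠ N in atTop, p N ≠ 0 := by
    filter_upwards [hp.eventually_ne hv] with N h
    exact right_ne_zero_of_mul h
  have hmle : ∀ᶠ N : ℕ in atTop, ‖m N‖ ≤ N := by
    filter_upwards [hm.norm.eventually_lt_const hw1, hN0] with N h h3
    rw [norm_mul, Complex.norm_real, Real.norm_of_nonneg (inv_pos.2 h3).le,
      inv_mul_lt_one₀ h3] at h
    exact h.le
  have hmple : ∀ᶠ N : ℕ in atTop, ‖m N + p N‖ ≤ N := by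
    have h1 := (hm.add hpN).norm
    rw [add_zero] at h1
    filter_upwards [h1.eventually_lt_const hw1, hN0] with N h h3
    rw [← mul_add, norm_mul, Complex.norm_real, Real.norm_of_nonneg (inv_pos.2 h3).le,
      inv_mul_lt_one₀ h3] at h
    exact h.le
  have hxle : ∀ᶠ N : ℕ in atTop, ‖p N / m N‖ < 1 / 2 :=
    hx.norm.eventually_lt_const (by simp)
  have him : Tendsto (fun N : ℕ => (logBranch k (((N : ℝ)⁻¹ : ℝ) * m N) +
      Complex.log (1 + p N / m N)).im) atTop (𝓝 (logBranch k w).im) := by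
    have h1 := (Complex.continuous_im.tendsto _).comp (hlogb.add hlog1)
    rwa [add_zero] at h1
  obtain ⟨-, l2, l3⟩ := logBranch_im_mem k w
  have him1 := him.eventually_const_lt (lt_of_le_of_lt
    (by positivity : (0 : ℝ) ≤ 2 * Real.pi * k) (l3 hw))
  have him2 := him.eventually_lt_const (lt_of_lt_of_le l2
    (by gcongr; exact_mod_cast hk : 2 * Real.pi * ((k : ℝ) + 1) ≤ 2 * Real.pi * b))
  filter_upwards [hmne, hmle, hpne, hmple, hxle, him1, him2, hrN, hN0]
    with N c1 c2 c3 c4 c5 c6 c7 c8 c9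
  have hexp := exp_logBranch k c1
  have him' : (logBranch k (m N) + Complex.log (1 + p N / m N)).im =
      (logBranch k (((N : ℝ)⁻¹ : ℝ) * m N) + Complex.log (1 + p N / m N)).im := by
    rw [c8, add_right_comm, Complex.add_im _ (Real.log N : ℂ), Complex.ofReal_im, add_zero]
  rw [levelTerm, if_pos ⟨c1, c2⟩, pairTerm, hexp, if_pos]
  · simp only [Function.comp_apply]
    congr 1
    have h1 : Complex.exp (α * Complex.log (1 + p N / m N)) - 1 =
        p N / m N * dslope P 0 (p N / m N) := by
      have := sub_smul_dslope P 0 (p N / m N)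
      simp only [sub_zero, smul_eq_mul] at this
      rw [this]
      simp [P]
    have h2 : Complex.exp (α * (logBranch k (m N) + Complex.log (1 + p N / m N))) -
        Complex.exp (α * logBranch k (m N)) =
        Complex.exp (α * logBranch k (m N)) * (p N / m N * dslope P 0 (p N / m N)) := by
      rw [← h1, mul_add, Complex.exp_add]
      ring
    have h3 : Complex.exp (α * logBranch k (m N)) / m N =
        Complex.exp (((α - 1 : ℝ) : ℂ) * logBranch k (((N : ℝ)⁻¹ : ℝ) * m N)) *
          (((N : ℝ) ^ (1 - α) : ℝ) : ℂ)⁻¹ := by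
      have h4 : (((N : ℝ) ^ (1 - α) : ℝ) : ℂ)⁻¹ =
          Complex.exp (((α - 1 : ℝ) : ℂ) * Real.log N) := by
        rw [← Complex.ofReal_inv, ← Real.rpow_neg c9.le, Real.rpow_def_of_pos c9]
        push_cast
        congr 1
        ring
      have h5 : Complex.exp (α * logBranch k (m N)) / m N =
          Complex.exp (α * logBranch k (m N)) / Complex.exp (logBranch k (m N)) := by rw [hexp]
      rw [h4, ← Complex.exp_add, ← mul_add, ← c8, h5, ← Complex.exp_sub]
      congr 1
      push_cast
      ring
    rw [h2, hℓ]
    calc _ = φ N * (((N : ℝ) ^ (1 - α) : ℝ) : ℂ)⁻¹ * p N *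
          Complex.exp (((α - 1 : ℝ) : ℂ) * logBranch k (((N : ℝ)⁻¹ : ℝ) * m N)) *
          dslope P 0 (p N / m N) := by
            push_cast
            ring
      _ = φ N * p N * (Complex.exp (α * logBranch k (m N)) / m N) *
          dslope P 0 (p N / m N) := by
            rw [h3]
            ring
      _ = _ := by ring
  · refine ⟨c3, ?_, c4, ?_, ?_⟩
    · rw [norm_div, div_lt_iff₀ (norm_pos_iff.2 c1)] at c5
      linarith
    · rw [him']
      exact c6.le
    · rwa [him']

open Classical in
/-- The limit of the normalized contribution of one logarithm, `u` being the limit of the value of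
`z ↦ z ^ (α - 1)` there: zero, an integral or a lattice sum according to whether the rescaled
lattice points `lam p` escape, become dense or stay discrete. -/
noncomputable def levelLimit (f : ℂ → ℂ) (α : ℝ) (L : Submodule ℤ ℂ) (lam : ℝ≥0∞) (u : ℂ) : ℂ :=
  if lam = ⊤ then 0
  else if lam = 0 then (ZLattice.covolume L : ℂ)⁻¹ * ∫ v : ℂ, f (α * u * v)
  else (lam.toReal : ℂ) ^ 2 * ∑' p : L, if p = 0 then 0 else f (α * u * (lam.toReal * p))

theorem levelTerm_norm_le {f : ℂ → ℂ} {M : ℝ} (hM : ∀ w, ‖f w‖ ≤ M) (α φ : ℝ) (N b : ℕ) (m : ℂ)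
    (k : ℕ) (p : ℂ) : ‖levelTerm f α φ N b m k p‖ ≤ M := by
  have h0 : 0 ≤ M := (norm_nonneg _).trans (hM 0)
  rw [levelTerm]
  split_ifs
  · rw [pairTerm]
    split_ifs
    · exact hM _
    · simpa using h0
  · simpa using h0

theorem tendsto_toReal_of_tendsto_ofReal {ℓ : ℕ → ℝ} (hℓ : ∀ᶠ N in atTop, 0 < ℓ N)
    {lam : ℝ≥0∞} (hlam : Tendsto (fun N => ENNReal.ofReal (ℓ N)) atTop (𝓝 lam)) (h : lam ≠ ⊤) :
    Tendsto ℓ atTop (𝓝 lam.toReal) := by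
  refine ((ENNReal.tendsto_toReal h).comp hlam).congr' ?_
  filter_upwards [hℓ] with N hN
  exact ENNReal.toReal_ofReal hN.le

theorem tendsto_atTop_of_tendsto_ofReal_top {ℓ : ℕ → ℝ}
    (hlam : Tendsto (fun N => ENNReal.ofReal (ℓ N)) atTop (𝓝 ⊤)) : Tendsto ℓ atTop atTop := by
  refine tendsto_atTop.2 fun x => ?_
  filter_upwards [hlam.eventually (lt_mem_nhds (ENNReal.ofReal_lt_top (r := x)))] with N hN
  by_contra hlt
  exact absurd (ENNReal.ofReal_le_ofReal (not_le.1 hlt).le) (not_le.2 hN)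

section Limits

variable {α : ℝ} {f : ℂ → ℂ} {φ : ℕ → ℝ} {lam : ℝ≥0∞}

/-- The asymptotics of the inner sum over the lattice vectors `p`, for the `k`-th logarithm of grid
points `z + m N` with `(z + m N) / N → w`. -/
theorem tendsto_level_sum (h0 : 0 < α) (h1 : α < 1) (L : Submodule ℤ ℂ) [DiscreteTopology L]
    [IsZLattice ℝ L] (z : ℂ) (hf : Continuous f) (hfc : HasCompactSupport f)
    (hφpos : ∀ N : ℕ, 1 ≤ N → 0 < φ N) (hφ : Tendsto φ atTop atTop)
    (hlam : Tendsto (fun N : ℕ => ENNReal.ofReal (φ N / (N : ℝ) ^ (1 - α))) atTop (𝓝 lam))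
    {b k : ℕ} (hk : k < b) {w : ℂ} (hw1 : ‖w‖ < 1) (hw : -w ∈ Complex.slitPlane) {m : ℕ → L}
    (hm : Tendsto (fun N : ℕ => (((N : ℝ)⁻¹ : ℝ) : ℂ) * (z + m N)) atTop (𝓝 w)) :
    Tendsto (fun N : ℕ => ((φ N / (N : ℝ) ^ (1 - α) : ℝ) : ℂ) ^ 2 *
        ∑' p : L, levelTerm f α (φ N) N b (z + m N) k p) atTop
      (𝓝 (levelLimit f α L lam (Complex.exp (((α - 1 : ℝ) : ℂ) * logBranch k w)))) := by
  obtain ⟨M, hM⟩ := hf.bounded_above_of_compact_support hfc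
  obtain ⟨R, hR, hfR⟩ := hfc.exists_pos_le_norm
  have hfR' : ∀ w, f w ≠ 0 → ‖w‖ ≤ R := fun w hw => le_of_lt (not_le.1 (mt (hfR w) hw))
  obtain ⟨δ, hδ, hmin⟩ := ZLattice.exists_norm_lower_bound L z
  obtain ⟨δ', hδ', hmin'⟩ := ZLattice.exists_norm_lower_bound L 0
  obtain ⟨T, K, hT, hK, hsupp⟩ := exists_levelTerm_support h0 h1 hδ hR.le hfR'
  set ℓ : ℕ → ℝ := fun N => φ N / (N : ℝ) ^ (1 - α) with hℓ
  have hℓpos : ∀ᶠ N in atTop, 0 < ℓ N := by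
    filter_upwards [eventually_ge_atTop 1] with N hN
    exact div_pos (hφpos N hN) (Real.rpow_pos_of_pos (by exact_mod_cast hN) _)
  have hs : ∀ᶠ N in atTop, ∀ p : L, levelTerm f α (φ N) N b (z + m N) k p ≠ 0 →
      p ≠ 0 ∧ ℓ N * ‖(p : ℂ)‖ ≤ K := by
    filter_upwards [hφ.eventually_ge_atTop T, eventually_gt_atTop 0] with N hN1 hN2 p hp
    obtain ⟨-, h3, h4⟩ := hsupp (φ N) N b (z + m N) k p hN1 hN2 (hmin (m N)) hp
    exact ⟨by simpa using h3, h4⟩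
  rw [levelLimit]
  split_ifs with ht hz
  · -- The spacing tends to infinity: eventually nothing is left in the support of `f`.
    rw [ht] at hlam
    have hℓt : Tendsto ℓ atTop atTop := tendsto_atTop_of_tendsto_ofReal_top hlam
    refine tendsto_const_nhds.congr' ?_
    filter_upwards [hs, hℓt.eventually_gt_atTop (K / δ')] with N h3 h4
    have h5 : ∀ p : L, levelTerm f α (φ N) N b (z + m N) k p = 0 := by
      intro p
      by_contra hp
      obtain ⟨h6, h7⟩ := h3 p hp
      have h8 := hmin' p (by simpa using h6)
      rw [zero_add] at h8
      rw [div_lt_iff₀ hδ'] at h4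
      have : 0 < ℓ N := pos_of_mul_pos_left (hK.trans_lt h4) hδ'.le
      nlinarith
    simp [h5]
  · -- The spacing tends to zero: a Riemann sum.
    have hℓ0 : Tendsto ℓ atTop (𝓝 0) := by
      have := tendsto_toReal_of_tendsto_ofReal hℓpos hlam ht
      rwa [hz] at this
    refine ZLattice.tendsto_scaled_tsum L 0 ℓ hℓpos hℓ0
      (fun N p => levelTerm f α (φ N) N b (z + m N) k p) M K ?_ ?_ _ ?_
    · exact Eventually.of_forall fun N p => levelTerm_norm_le hM _ _ _ _ _ _ _
    · filter_upwards [hs, hℓpos] with N h3 h4 p hp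
      rw [zero_add, norm_mul, Complex.norm_real, Real.norm_of_nonneg h4.le]
      exact (h3 p hp).2
    · have hne : ∀ᵐ v : ℂ, v ≠ 0 := by
        simp [ae_iff]
      filter_upwards [hne] with v hv p hp
      simp only [zero_add] at hp
      exact tendsto_levelTerm h0 hf hφ hk hw1 hw hv hm hp
  · -- The spacing has a positive limit: only finitely many lattice points matter.
    have hℓl := tendsto_toReal_of_tendsto_ofReal hℓpos hlam ht
    set l := lam.toReal with hl
    have hlpos : 0 < l := ENNReal.toReal_pos hz ht
    refine Tendsto.mul (((Complex.continuous_ofReal.tendsto _).comp hℓl).pow 2) ?_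
    have hfin := ZLattice.finite_norm_le L 0 (2 * K / l)
    refine tendsto_tsum_of_dominated_convergence
      (bound := Set.indicator {p : L | ‖(0 : ℂ) + p‖ ≤ 2 * K / l} fun _ => M) ?_ ?_ ?_
    · refine summable_of_hasFiniteSupport (hfin.subset ?_)
      exact Set.support_indicator_subset
    · intro p
      split_ifs with hp
      · refine tendsto_const_nhds.congr' ?_
        filter_upwards [hs] with N h3
        by_contra h4
        exact (h3 p (fun h => h4 h.symm)).1 hp
      · refine tendsto_levelTerm h0 hf hφ hk hw1 hw (v := l * p) ?_ hm ?_
        · simpa [hlpos.ne'] using hp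
        · exact ((Complex.continuous_ofReal.tendsto _).comp hℓl).mul_const _
    · filter_upwards [hs, hℓl.eventually_const_lt (half_lt_self hlpos)] with N h3 h4 p
      by_cases hp : levelTerm f α (φ N) N b (z + m N) k p = 0
      · rw [hp, norm_zero]
        exact Set.indicator_nonneg (fun _ _ => (norm_nonneg _).trans (hM 0)) _
      · rw [Set.indicator_of_mem]
        · exact levelTerm_norm_le hM _ _ _ _ _ _ _
        · have h5 := (h3 p hp).2
          rw [Set.mem_ofPred_eq, zero_add, le_div_iff₀ hlpos]
          nlinarith [norm_nonneg (p : ℂ)]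

/-- The normalized contribution of a single logarithm is bounded, uniformly over the grid. -/
theorem exists_level_sum_bound (h0 : 0 < α) (h1 : α < 1) (L : Submodule ℤ ℂ) [DiscreteTopology L]
    [IsZLattice ℝ L] (z : ℂ) (hf : Continuous f) (hfc : HasCompactSupport f)
    (hφpos : ∀ N : ℕ, 1 ≤ N → 0 < φ N) (hφ : Tendsto φ atTop atTop) (b : ℕ) :
    ∃ C : ℝ, ∀ᶠ N : ℕ in atTop, ∀ (m : L) (k : ℕ), ‖((φ N / (N : ℝ) ^ (1 - α) : ℝ) : ℂ) ^ 2 *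
        ∑' p : L, levelTerm f α (φ N) N b (z + m) k p‖ ≤ C := by
  obtain ⟨M, hM⟩ := hf.bounded_above_of_compact_support hfc
  obtain ⟨R, hR, hfR⟩ := hfc.exists_pos_le_norm
  have hfR' : ∀ w, f w ≠ 0 → ‖w‖ ≤ R := fun w hw => le_of_lt (not_le.1 (mt (hfR w) hw))
  obtain ⟨δ, hδ, hmin⟩ := ZLattice.exists_norm_lower_bound L z
  obtain ⟨T, K, hT, hK, hsupp⟩ := exists_levelTerm_support h0 h1 hδ hR.le hfR'
  obtain ⟨C, hC, hbound⟩ := ZLattice.exists_scaled_tsum_bound L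
  refine ⟨C * K ^ 2 * M, ?_⟩
  filter_upwards [hφ.eventually_ge_atTop T, eventually_gt_atTop 0] with N hN1 hN2 m k
  have hℓ : 0 < φ N / (N : ℝ) ^ (1 - α) :=
    div_pos (hφpos N hN2) (Real.rpow_pos_of_pos (by exact_mod_cast hN2) _)
  rw [norm_mul, norm_pow, Complex.norm_real, Real.norm_of_nonneg hℓ.le]
  refine hbound K _ M _ hℓ ((norm_nonneg _).trans (hM 0))
    (fun p => levelTerm_norm_le hM _ _ _ _ _ _ _) fun p hp => ?_
  obtain ⟨-, h3, h4⟩ := hsupp (φ N) N b (z + m) k p hN1 hN2 (hmin m) hp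
  exact ⟨by simpa using h3, h4⟩

theorem ae_neg_mem_slitPlane : ∀ᵐ w : ℂ, -w ∈ Complex.slitPlane := by
  have hker : LinearMap.ker Complex.imLm ≠ ⊤ := by
    intro h
    have : Complex.I ∈ LinearMap.ker Complex.imLm := h ▸ Submodule.mem_top
    simp at this
  have h1 := measure_eq_zero_iff_ae_notMem.1 (Measure.addHaar_submodule volume _ hker)
  filter_upwards [h1] with w hw
  refine Complex.mem_slitPlane_iff.2 (Or.inr ?_)
  simpa using hw

/-- The asymptotics of the outer sum over the grid. The limit only involves the points `w` of the
open disc, the unit circle and the cut being negligible. -/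
theorem tendsto_grid_sum (h0 : 0 < α) (h1 : α < 1) (L : Submodule ℤ ℂ) [DiscreteTopology L]
    [IsZLattice ℝ L] (z : ℂ) (hf : Continuous f) (hfc : HasCompactSupport f)
    (hφpos : ∀ N : ℕ, 1 ≤ N → 0 < φ N) (hφ : Tendsto φ atTop atTop)
    (hlam : Tendsto (fun N : ℕ => ENNReal.ofReal (φ N / (N : ℝ) ^ (1 - α))) atTop (𝓝 lam))
    (b : ℕ) :
    Tendsto (fun N : ℕ => (((N : ℝ)⁻¹ : ℝ) : ℂ) ^ 2 * ∑' m : L, ∑ k : Fin b,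
        ((φ N / (N : ℝ) ^ (1 - α) : ℝ) : ℂ) ^ 2 *
          ∑' p : L, levelTerm f α (φ N) N b (z + m) k p) atTop
      (𝓝 ((ZLattice.covolume L : ℂ)⁻¹ * ∫ w in Metric.ball (0 : ℂ) 1, ∑ k : Fin b,
        levelLimit f α L lam (Complex.exp (((α - 1 : ℝ) : ℂ) * logBranch k w)))) := by
  obtain ⟨C, hC⟩ := exists_level_sum_bound h0 h1 L z hf hfc hφpos hφ b
  have hN0 : ∀ᶠ N : ℕ in atTop, 0 < (N : ℝ) := by
    filter_upwards [eventually_gt_atTop 0] with N hN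
    exact_mod_cast hN
  have hlarge : ∀ (N : ℕ) (m : L), ¬ ‖z + (m : ℂ)‖ ≤ N → (∑ k : Fin b,
        ((φ N / (N : ℝ) ^ (1 - α) : ℝ) : ℂ) ^ 2 *
          ∑' p : L, levelTerm f α (φ N) N b (z + m) k p) = 0 := by
    intro N m hm
    have : ∀ (k : ℕ) (p : L), levelTerm f α (φ N) N b (z + m) k p = 0 := fun k p => by
      rw [levelTerm, if_neg fun h => hm h.2]
    simp [this]
  rw [← integral_indicator Metric.isOpen_ball.measurableSet]
  refine ZLattice.tendsto_scaled_tsum L z (fun N => (N : ℝ)⁻¹) ?_ ?_ _ (b * C) 1 ?_ ?_ _ ?_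
  · filter_upwards [hN0] with N hN
    exact inv_pos.2 hN
  · exact tendsto_inv_atTop_zero.comp tendsto_natCast_atTop_atTop
  · filter_upwards [hC] with N hN m
    refine (norm_sum_le _ _).trans
      ((Finset.sum_le_sum fun (k : Fin b) _ => hN m (k : ℕ)).trans ?_)
    simp
  · filter_upwards [hN0] with N hN m hm
    by_contra hlt
    refine hm (hlarge N m fun h => hlt ?_)
    rw [norm_mul, Complex.norm_real, Real.norm_of_nonneg (inv_pos.2 hN).le, inv_mul_le_one₀ hN]
    exact h
  · have hsphere : ∀ᵐ w : ℂ, w ∉ Metric.sphere (0 : ℂ) 1 :=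
      measure_eq_zero_iff_ae_notMem.1 (Measure.addHaar_sphere _ _ _)
    filter_upwards [hsphere, ae_neg_mem_slitPlane] with w hw1 hw2 m hm
    by_cases hw : ‖w‖ < 1
    · rw [Set.indicator_of_mem (mem_ball_zero_iff.2 hw)]
      exact tendsto_finsetSum _ fun k _ =>
        tendsto_level_sum h0 h1 L z hf hfc hφpos hφ hlam k.2 hw hw2 hm
    · rw [Set.indicator_of_notMem (by simpa using hw)]
      have hw3 : 1 < ‖w‖ := lt_of_le_of_ne (not_lt.1 hw) fun h => hw1 (by simp [← h])
      refine tendsto_const_nhds.congr' ?_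
      filter_upwards [hm.norm.eventually_const_lt hw3, hN0] with N h3 h4
      rw [norm_mul, Complex.norm_real, Real.norm_of_nonneg (inv_pos.2 h4).le,
        one_lt_inv_mul₀ h4] at h3
      exact (hlarge N (m N) (not_le.2 h3)).symm

end Limits

/-! ### Evaluation of the limit integrals in polar coordinates -/

theorem integral_eq_integral_polar {G : ℂ → ℂ} (hG : Measurable G) {M R : ℝ}
    (hM : ∀ w, ‖G w‖ ≤ M) (hR : ∀ w, G w ≠ 0 → ‖w‖ ≤ R) :
    ∫ w, G w = ∫ x in Set.Ioi (0 : ℝ), (x : ℂ) * ∫ θ in Set.Ioo (-Real.pi) Real.pi,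
      G (x * Complex.exp (θ * Complex.I)) := by
  have hsymm : ∀ p : ℝ × ℝ, Complex.polarCoord.symm p =
      p.1 * Complex.exp (p.2 * Complex.I) := by
    intro p
    rw [Complex.polarCoord_symm_apply, Complex.exp_mul_I]
    push_cast
    ring
  rw [← Complex.integral_comp_polarCoord_symm]
  simp_rw [hsymm]
  rw [polarCoord_target, Measure.volume_eq_prod, setIntegral_prod]
  · refine setIntegral_congr_fun measurableSet_Ioi fun x _ => ?_
    simp only [Complex.real_smul]
    rw [integral_const_mul]
  · have hM0 : 0 ≤ M := (norm_nonneg _).trans (hM 0)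
    have hmeas : Measurable fun p : ℝ × ℝ =>
        p.1 • G (p.1 * Complex.exp (p.2 * Complex.I)) := by
      refine measurable_fst.smul (hG.comp ?_)
      fun_prop
    refine IntegrableOn.of_forall_sdiff_eq_zero
      (s := Set.Ioc 0 R ×ˢ Set.Ioo (-Real.pi) Real.pi) ?_
      (measurableSet_Ioi.prod measurableSet_Ioo) ?_
    · refine Measure.integrableOn_of_bounded (M := R * M) ?_ hmeas.aestronglyMeasurable ?_
      · rw [Measure.prod_prod]
        simp only [Real.volume_Ioc, Real.volume_Ioo]
        finiteness
      · refine (ae_restrict_mem (measurableSet_Ioc.prod measurableSet_Ioo)).mono fun p hp => ?_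
        rw [norm_smul, Real.norm_of_nonneg hp.1.1.le]
        exact mul_le_mul hp.1.2 (hM _) (norm_nonneg _) (hp.1.1.le.trans hp.1.2)
    · rintro ⟨x, θ⟩ ⟨⟨hx, hθ⟩, hn⟩
      by_contra h
      have h1 : G (x * Complex.exp (θ * Complex.I)) ≠ 0 := right_ne_zero_of_smul h
      have h2 := hR _ h1
      rw [norm_mul, Complex.norm_real, Complex.norm_exp_ofReal_mul_I, mul_one,
        Real.norm_of_nonneg (le_of_lt hx)] at h2
      exact hn ⟨⟨hx, h2⟩, hθ⟩

theorem measurable_logBranch (k : ℕ) : Measurable (logBranch k) := by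
  refine Measurable.add ?_ measurable_const
  refine Measurable.ite ?_ ?_ Complex.measurable_log
  · exact (Complex.isOpen_slitPlane.preimage continuous_neg).measurableSet
  · exact (Complex.measurable_log.comp measurable_neg).add measurable_const

/-- A periodic function averaged along the `b` levels: `θ ↦ (a / b - 1) θ` maps `[0, 2πb]` onto a
whole number of periods. -/
theorem sum_integral_periodic {a b : ℕ} (hab : a < b) {F : ℝ → ℂ} (hF : Continuous F)
    (hper : Function.Periodic F (2 * Real.pi)) (σ : ℝ) :
    ∑ k : Fin b, ∫ θ in -Real.pi..Real.pi,
        F (σ + ((a : ℝ) / b - 1) * (θ + Real.pi + 2 * Real.pi * (k : ℕ))) =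
      b * ∫ θ in -Real.pi..Real.pi, F θ := by
  have hb : (0 : ℝ) < b := by exact_mod_cast (Nat.zero_le a).trans_lt hab
  have hab' : (a : ℝ) < b := by exact_mod_cast hab
  set c : ℝ := (a : ℝ) / b - 1 with hc
  have hcb : c * b = a - b := by
    rw [hc]
    field_simp
  have hc0 : c ≠ 0 := by
    intro h
    rw [h, zero_mul] at hcb
    linarith
  have h1 : ∀ k : ℕ, ∫ θ in -Real.pi..Real.pi, F (σ + c * (θ + Real.pi + 2 * Real.pi * k)) =
      ∫ θ in (2 * Real.pi * (k : ℕ))..(2 * Real.pi * ((k + 1 : ℕ) : ℝ)), F (σ + c * θ) := by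
    intro k
    have := intervalIntegral.integral_comp_add_right (a := -Real.pi) (b := Real.pi)
      (fun θ => F (σ + c * θ)) (Real.pi + 2 * Real.pi * k)
    simp only [← add_assoc] at this
    rw [this]
    congr 1
    · ring
    · push_cast
      ring
  rw [Fin.sum_univ_eq_sum_range
    (fun k : ℕ => ∫ θ in -Real.pi..Real.pi, F (σ + c * (θ + Real.pi + 2 * Real.pi * k))) b]
  simp_rw [h1]
  rw [intervalIntegral.sum_integral_adjacent_intervals
    (a := fun k : ℕ => 2 * Real.pi * (k : ℝ))]
  · rw [intervalIntegral.integral_comp_add_mul _ hc0]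
    have h2 : σ + c * (2 * Real.pi * (b : ℝ)) =
        σ + ((a : ℤ) - (b : ℤ)) • (2 * Real.pi) := by
      rw [zsmul_eq_mul]
      push_cast
      linear_combination 2 * Real.pi * hcb
    rw [h2, Nat.cast_zero, mul_zero, mul_zero, add_zero, hper.intervalIntegral_add_zsmul_eq _ _
      (fun _ _ => hF.intervalIntegrable _ _)]
    have h3 := hper.intervalIntegral_add_eq σ (-Real.pi)
    have h4 : -Real.pi + 2 * Real.pi = Real.pi := by ring
    rw [h4] at h3
    rw [h3, zsmul_eq_mul, Complex.real_smul, ← mul_assoc]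
    congr 1
    have h5 : c⁻¹ * ((a : ℝ) - b) = b := by
      rw [← hcb]
      field_simp
    rw [← Complex.ofReal_natCast b, ← h5]
    push_cast
    ring
  · intro k _
    exact Continuous.intervalIntegrable (by fun_prop) _ _

/-- Substituting `y = C x ^ (α - 1)` on the half-line. -/
theorem integral_comp_rpow_sub_one {α : ℝ} (h1 : α < 1) {C : ℝ} (hC : 0 < C) (g : ℝ → ℂ) :
    ∫ y in Set.Ioi (0 : ℝ), g y =
      ∫ x in Set.Ioi (0 : ℝ), (C * ((1 - α) * x ^ (α - 2)) : ℝ) • g (C * x ^ (α - 1)) := by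
  have h2 := integral_comp_mul_left_Ioi g 0 hC
  rw [mul_zero] at h2
  have h3 := integral_comp_rpow_Ioi (fun y => g (C * y)) (p := α - 1) (by linarith)
  rw [h2] at h3
  have h4 : |α - 1| = 1 - α := by
    rw [abs_of_neg (by linarith)]
    ring
  simp_rw [mul_smul C, integral_smul]
  have h5 : α - 1 - 1 = α - 2 := by ring
  rw [h4, h5] at h3
  rw [h3, smul_inv_smul₀ hC.ne']

open Classical in
/-- The rotation invariant density, at distance `y` from the origin, of the image of Lebesgue
measure on the unit disc under `w ↦ c w ^ (α - 1)`, averaged over the branches of the power. It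
depends on `c` through `C = ‖c‖` only, and is supported on `y ≥ C` because the exponent `α - 1` is
negative. -/
noncomputable def radialKernel (α C y : ℝ) : ℝ :=
  if C ≤ y then 1 / (1 - α) * C ^ (2 / (1 - α)) * y ^ (-((4 - 2 * α) / (1 - α))) else 0

theorem radialKernel_nonneg {α C y : ℝ} (h1 : α < 1) (hC : 0 < C) : 0 ≤ radialKernel α C y := by
  rw [radialKernel]
  split_ifs with h
  · have : 0 < 1 - α := by linarith
    have : 0 < y := hC.trans_le h
    positivity
  · rfl

theorem radialKernel_le {α C y : ℝ} (h1 : α < 1) (hC : 0 < C) :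
    radialKernel α C y ≤ 1 / (1 - α) * C ^ (2 / (1 - α)) * C ^ (-((4 - 2 * α) / (1 - α))) := by
  have h2 : 0 < 1 - α := by linarith
  rw [radialKernel]
  split_ifs with h
  · refine mul_le_mul_of_nonneg_left ?_ (by positivity)
    refine Real.rpow_le_rpow_of_nonpos hC h ?_
    rw [neg_nonpos]
    exact div_nonneg (by linarith) h2.le
  · positivity

theorem measurable_radialKernel (α C : ℝ) : Measurable (radialKernel α C) := by
  refine Measurable.ite measurableSet_Ici ?_ measurable_const
  fun_prop

/-- Under the substitution `y = C x ^ (α - 1)` the radial measure `y * radialKernel α C y` becomes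
`x` on `0 < x ≤ 1`, the radial part of Lebesgue measure on the unit disc. -/
theorem radialKernel_comp_rpow {α : ℝ} (h1 : α < 1) {C x : ℝ} (hC : 0 < C) (hx : 0 < x) :
    C * ((1 - α) * x ^ (α - 2)) * (C * x ^ (α - 1) * radialKernel α C (C * x ^ (α - 1))) =
      if x ≤ 1 then x else 0 := by
  have h2 : 0 < 1 - α := by linarith
  have hiff : C ≤ C * x ^ (α - 1) ↔ x ≤ 1 := by
    rw [le_mul_iff_one_le_right hC]
    constructor
    · intro h
      by_contra hlt
      exact absurd h (not_le.2 (Real.rpow_lt_one_of_one_lt_of_neg (not_le.1 hlt) (by linarith)))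
    · intro h
      exact Real.one_le_rpow_of_pos_of_le_one_of_nonpos hx h (by linarith)
  rw [radialKernel]
  simp only [hiff]
  split_ifs with h
  · rw [Real.mul_rpow hC.le (Real.rpow_nonneg hx.le _), ← Real.rpow_mul hx.le]
    have e1 : (α - 1) * -((4 - 2 * α) / (1 - α)) = 4 - 2 * α := by
      field_simp
      ring
    have e2 : C * C * (C ^ (2 / (1 - α)) * C ^ (-((4 - 2 * α) / (1 - α)))) = 1 := by
      rw [← Real.rpow_add hC, ← sq, ← Real.rpow_natCast C 2, ← Real.rpow_add hC]
      have : ((2 : ℕ) : ℝ) + (2 / (1 - α) + -((4 - 2 * α) / (1 - α))) = 0 := by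
        push_cast
        field_simp
        ring
      rw [this, Real.rpow_zero]
    have e3 : x ^ (α - 2) * x ^ (α - 1) * x ^ (4 - 2 * α) = x := by
      rw [← Real.rpow_add hx, ← Real.rpow_add hx]
      have : α - 2 + (α - 1) + (4 - 2 * α) = 1 := by ring
      rw [this, Real.rpow_one]
    rw [e1]
    calc _ = ((1 - α) * (1 / (1 - α))) *
          (C * C * (C ^ (2 / (1 - α)) * C ^ (-((4 - 2 * α) / (1 - α))))) *
          (x ^ (α - 2) * x ^ (α - 1) * x ^ (4 - 2 * α)) := by ring
      _ = x := by
        rw [e2, e3]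
        field_simp
  · ring

theorem log_ofReal_mul_exp_mul_I {x θ : ℝ} (hx : 0 < x)
    (hθ : θ ∈ Set.Ioo (-Real.pi) Real.pi) :
    Complex.log (x * Complex.exp (θ * Complex.I)) = Real.log x + θ * Complex.I := by
  rw [Complex.log_ofReal_mul hx (Complex.exp_ne_zero _), Complex.log_exp]
  · simpa using hθ.1
  · simpa using hθ.2.le

theorem ofReal_mul_exp_mul_I_mem_slitPlane {x θ : ℝ} (hx : 0 < x)
    (hθ : θ ∈ Set.Ioo (-Real.pi) Real.pi) :
    (x * Complex.exp (θ * Complex.I) : ℂ) ∈ Complex.slitPlane := by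
  have h := log_ofReal_mul_exp_mul_I hx hθ
  rw [Complex.mem_slitPlane_iff_arg]
  refine ⟨?_, mul_ne_zero (by exact_mod_cast hx.ne') (Complex.exp_ne_zero _)⟩
  rw [← Complex.log_im, h]
  simpa using hθ.2.ne

theorem exp_mul_logBranch_neg {x θ : ℝ} (hx : 0 < x) (hθ : θ ∈ Set.Ioo (-Real.pi) Real.pi)
    (β : ℝ) (k : ℕ) :
    Complex.exp ((β : ℂ) * logBranch k (-(x * Complex.exp (θ * Complex.I)))) =
      ((x ^ β : ℝ) : ℂ) *
        Complex.exp ((β * (θ + Real.pi + 2 * Real.pi * k) : ℝ) * Complex.I) := by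
  rw [logBranch_neg k (ofReal_mul_exp_mul_I_mem_slitPlane hx hθ),
    log_ofReal_mul_exp_mul_I hx hθ, Real.rpow_def_of_pos hx, Complex.ofReal_exp,
    ← Complex.exp_add]
  congr 1
  push_cast
  ring

/-- The powers `w ^ (a / b - 1)` along the `b` levels over the unit disc, scaled by `c`, are
distributed according to `b` times the rotation invariant density `radialKernel`. -/
theorem integral_ball_sum_levels {a b : ℕ} (hab : a < b) {f : ℂ → ℂ} (hf : Continuous f)
    (hfc : HasCompactSupport f) {c : ℂ} (hc : c ≠ 0) :
    ∫ w in Metric.ball (0 : ℂ) 1, ∑ k : Fin b,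
        f (c * Complex.exp (((((a : ℝ) / b) - 1 : ℝ) : ℂ) * logBranch k w)) =
      b * ∫ z : ℂ, (radialKernel ((a : ℝ) / b) ‖c‖ ‖z‖ : ℂ) * f z := by
  obtain ⟨M, hM⟩ := hf.bounded_above_of_compact_support hfc
  obtain ⟨R, hR, hfR⟩ := hfc.exists_pos_le_norm
  have hM0 : 0 ≤ M := (norm_nonneg _).trans (hM 0)
  have hb : (0 : ℝ) < b := by exact_mod_cast (Nat.zero_le a).trans_lt hab
  set α : ℝ := (a : ℝ) / b with hα
  have h1 : α < 1 := (div_lt_one hb).2 (by exact_mod_cast hab)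
  have hC : 0 < ‖c‖ := norm_pos_iff.2 hc
  set F : ℂ → ℂ := fun w => ∑ k : Fin b,
    f (c * Complex.exp (((α - 1 : ℝ) : ℂ) * logBranch k w)) with hFdef
  have hFm : Measurable F := by
    refine Finset.measurable_sum _ fun k _ => hf.measurable.comp ?_
    exact (Complex.measurable_exp.comp ((measurable_logBranch k).const_mul _)).const_mul _
  -- Reflect the plane, so that the cut of `logBranch` becomes that of the principal branch.
  have hL : ∫ w in Metric.ball (0 : ℂ) 1, F w =
      ∫ w, (Metric.ball (0 : ℂ) 1).indicator F (-w) := by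
    rw [integral_neg_eq_self (fun w => (Metric.ball (0 : ℂ) 1).indicator F w),
      integral_indicator Metric.isOpen_ball.measurableSet]
  rw [hL, integral_eq_integral_polar
    (G := fun w => (Metric.ball (0 : ℂ) 1).indicator F (-w)) (M := b * M) (R := 1)
    ((hFm.indicator Metric.isOpen_ball.measurableSet).comp measurable_neg)]
  rotate_left
  · intro w
    refine (norm_indicator_le_norm_self _ _).trans ((norm_sum_le _ _).trans ?_)
    refine (Finset.sum_le_sum fun (k : Fin b) _ => hM _).trans ?_
    simp
  · intro w hw
    have := Set.mem_of_indicator_ne_zero hw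
    rw [mem_ball_zero_iff, norm_neg] at this
    exact this.le
  rw [integral_eq_integral_polar
    (G := fun z => (radialKernel α ‖c‖ ‖z‖ : ℂ) * f z)
    (M := (1 / (1 - α) * ‖c‖ ^ (2 / (1 - α)) * ‖c‖ ^ (-((4 - 2 * α) / (1 - α)))) * M) (R := R)]
  rotate_left
  · exact (Complex.measurable_ofReal.comp
      ((measurable_radialKernel α ‖c‖).comp measurable_norm)).mul hf.measurable
  · intro z
    rw [norm_mul, Complex.norm_real, Real.norm_of_nonneg (radialKernel_nonneg h1 hC)]
    exact mul_le_mul (radialKernel_le h1 hC) (hM z) (norm_nonneg _)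
      ((radialKernel_nonneg h1 hC).trans (radialKernel_le (y := 0) h1 hC))
  · intro z hz
    exact le_of_lt (not_le.1 (mt (hfR z) (right_ne_zero_of_mul hz)))
  rw [integral_comp_rpow_sub_one h1 hC fun y : ℝ => (y : ℂ) *
      ∫ θ in Set.Ioo (-Real.pi) Real.pi,
        (radialKernel α ‖c‖ ‖(y * Complex.exp (θ * Complex.I) : ℂ)‖ : ℂ) *
          f (y * Complex.exp (θ * Complex.I)), ← integral_const_mul]
  refine setIntegral_congr_ae measurableSet_Ioi ?_
  filter_upwards [Measure.ae_ne volume (1 : ℝ)] with x hxne hx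
  have hx0 : 0 < x := hx
  have hy0 : 0 < ‖c‖ * x ^ (α - 1) := mul_pos hC (Real.rpow_pos_of_pos hx0 _)
  have hnorm : ∀ {y : ℝ}, 0 < y → ∀ θ : ℝ, ‖(y * Complex.exp (θ * Complex.I) : ℂ)‖ = y := by
    intro y hy θ
    rw [norm_mul, Complex.norm_real, Complex.norm_exp_ofReal_mul_I, mul_one,
      Real.norm_of_nonneg hy.le]
  simp only [hnorm hy0]
  rw [integral_const_mul, Complex.real_smul]
  have hker := radialKernel_comp_rpow h1 hC hx0
  set J := ∫ θ in Set.Ioo (-Real.pi) Real.pi,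
    f (((‖c‖ * x ^ (α - 1) : ℝ) : ℂ) * Complex.exp (θ * Complex.I)) with hJ
  have hker' : (b : ℂ) * (((‖c‖ * ((1 - α) * x ^ (α - 2)) : ℝ) : ℂ) *
      (((‖c‖ * x ^ (α - 1) : ℝ) : ℂ) *
        ((radialKernel α ‖c‖ (‖c‖ * x ^ (α - 1)) : ℂ) * J))) =
      b * (((if x ≤ 1 then x else 0 : ℝ) : ℂ) * J) := by
    rw [← hker]
    push_cast
    ring
  rw [hker']
  -- The circle `x = 1` is excluded: there the open disc and the closed support of the kernel
  -- differ.
  by_cases hx1 : x < 1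
  · rw [if_pos hx1.le]
    have hin : ∀ θ ∈ Set.Ioo (-Real.pi) Real.pi,
        (Metric.ball (0 : ℂ) 1).indicator F (-(x * Complex.exp (θ * Complex.I))) =
        ∑ k : Fin b, f (((‖c‖ * x ^ (α - 1) : ℝ) : ℂ) * Complex.exp
          ((c.arg + (α - 1) * (θ + Real.pi + 2 * Real.pi * (k : ℕ)) : ℝ) * Complex.I)) := by
      intro θ hθ
      rw [Set.indicator_of_mem (by rw [mem_ball_zero_iff, norm_neg, hnorm hx0]; exact hx1)]
      refine Finset.sum_congr rfl fun k _ => ?_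
      rw [exp_mul_logBranch_neg hx0 hθ]
      congr 1
      conv_lhs => rw [← Complex.norm_mul_exp_arg_mul_I c]
      push_cast
      rw [add_mul, Complex.exp_add]
      ring
    rw [setIntegral_congr_fun measurableSet_Ioo hin]
    have hpi : -Real.pi ≤ Real.pi := by linarith [Real.pi_pos]
    rw [hJ, ← integral_Ioc_eq_integral_Ioo, ← integral_Ioc_eq_integral_Ioo,
      ← intervalIntegral.integral_of_le hpi, ← intervalIntegral.integral_of_le hpi,
      intervalIntegral.integral_finsetSum]
    · have hs := sum_integral_periodic hab
        (F := fun θ : ℝ => f (((‖c‖ * x ^ (α - 1) : ℝ) : ℂ) * Complex.exp (θ * Complex.I)))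
        (by fun_prop) (fun θ => ?_) c.arg
      · rw [← hα] at hs
        rw [hs]
        ring
      · simp only
        congr 2
        rw [← Complex.exp_periodic (θ * Complex.I)]
        congr 1
        push_cast
        ring
    · intro k _
      exact Continuous.intervalIntegrable (by fun_prop) _ _
  · have hin : ∀ θ ∈ Set.Ioo (-Real.pi) Real.pi,
        (Metric.ball (0 : ℂ) 1).indicator F (-(x * Complex.exp (θ * Complex.I))) = 0 := by
      intro θ _
      refine Set.indicator_of_notMem ?_ _
      rw [mem_ball_zero_iff, norm_neg, hnorm hx0]
      exact hx1
    rw [setIntegral_congr_fun measurableSet_Ioo hin,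
      if_neg fun h => hx1 (lt_of_le_of_ne h hxne)]
    simp

theorem integral_comp_complex_mul_left (f : ℂ → ℂ) {c : ℂ} (hc : c ≠ 0) :
    ∫ v, f (c * v) = ((‖c‖ ^ 2)⁻¹ : ℝ) * ∫ v, f v := by
  set e : Circle := Circle.exp c.arg with he
  have h1 : ∀ v : ℂ, f (c * v) = (fun v => f (‖c‖ • v)) (rotation e v) := by
    intro v
    simp only [rotation_apply, Complex.real_smul, he, Circle.coe_exp]
    rw [← mul_assoc, Complex.norm_mul_exp_arg_mul_I]
  simp_rw [h1]
  rw [(rotation e).measurePreserving.integral_comp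
    (rotation e).toHomeomorph.measurableEmbedding (fun v => f (‖c‖ • v)),
    Measure.integral_comp_smul, Complex.finrank_real_complex, Complex.real_smul,
    abs_of_nonneg (by positivity)]

theorem integral_ball_norm_rpow {s : ℝ} (hs : 0 ≤ s) :
    ∫ w in Metric.ball (0 : ℂ) 1, ‖w‖ ^ s = 2 * Real.pi / (s + 2) := by
  have h1 : (Metric.ball (0 : ℂ) 1).indicator (fun w => ‖w‖ ^ s) =
      fun w => (Set.Iio (1 : ℝ)).indicator (fun y => y ^ s) ‖w‖ := by
    ext w
    by_cases hw : ‖w‖ < 1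
    · rw [Set.indicator_of_mem (by simpa using hw), Set.indicator_of_mem (by simpa using hw)]
    · rw [Set.indicator_of_notMem (by simpa using hw), Set.indicator_of_notMem (by simpa using hw)]
  rw [← integral_indicator Metric.isOpen_ball.measurableSet, h1,
    integral_fun_norm_addHaar volume, Complex.finrank_real_complex, measureReal_def,
    Complex.volume_ball]
  have h2 : ∀ y ∈ Set.Ioi (0 : ℝ), y ^ (2 - 1) • (Set.Iio (1 : ℝ)).indicator (fun y => y ^ s) y =
      (Set.Iio (1 : ℝ)).indicator (fun y => y ^ (s + 1)) y := by
    intro y hy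
    by_cases hy1 : y ∈ Set.Iio (1 : ℝ)
    · rw [Set.indicator_of_mem hy1, Set.indicator_of_mem hy1, Real.rpow_add hy, Real.rpow_one,
        smul_eq_mul, pow_one, mul_comm]
    · rw [Set.indicator_of_notMem hy1, Set.indicator_of_notMem hy1, smul_zero]
  rw [setIntegral_congr_fun measurableSet_Ioi h2, setIntegral_indicator measurableSet_Iio]
  have h3 : Set.Ioi (0 : ℝ) ∩ Set.Iio 1 = Set.Ioo 0 1 := rfl
  rw [h3, ← integral_Ioc_eq_integral_Ioo, ← intervalIntegral.integral_of_le zero_le_one,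
    integral_rpow (Or.inl (by linarith))]
  have h4 : s + 1 + 1 ≠ 0 := by linarith
  have h5 : s + 2 ≠ 0 := by linarith
  rw [Real.one_rpow, Real.zero_rpow h4]
  simp
  field_simp
  ring

theorem norm_exp_mul_logBranch {β : ℝ} (k : ℕ) {w : ℂ} (hw : w ≠ 0) :
    ‖Complex.exp ((β : ℂ) * logBranch k w)‖ = ‖w‖ ^ β := by
  rw [norm_exp_ofReal_mul, exp_logBranch k hw]

/-! ### The limit density -/

section Density

variable {α : ℝ} {lam : ℝ≥0∞}

/-- The nonzero lattice points which contribute to the limit density within distance `R`, when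
`lam = l` is positive and finite. -/
noncomputable def relevantPoints (L : Submodule ℤ ℂ) [DiscreteTopology L] (α l R : ℝ) :
    Finset L :=
  (ZLattice.finite_norm_le L 0 (R / (α * l))).toFinset.erase 0

theorem mem_relevantPoints {L : Submodule ℤ ℂ} [DiscreteTopology L] {l R : ℝ} (hαl : 0 < α * l)
    {p : L} : p ∈ relevantPoints L α l R ↔ p ≠ 0 ∧ α * l * ‖(p : ℂ)‖ ≤ R := by
  rw [relevantPoints, Finset.mem_erase, Set.Finite.mem_toFinset, Set.mem_ofPred_eq, zero_add,
    le_div_iff₀ hαl, mul_comm]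

/-- Within a bounded region the limit density is a finite combination of radial kernels. -/
theorem limitDensity_eq_sum_radialKernel (h0 : 0 < α) (h1 : α < 1) (L : Submodule ℤ ℂ)
    [DiscreteTopology L] [IsZLattice ℝ L] (ht : lam ≠ ⊤) (hz : lam ≠ 0) {R : ℝ} {z : ℂ}
    (hzR : ‖z‖ ≤ R) :
    limitDensity α L lam z = (ZLattice.covolume L)⁻¹ * lam.toReal ^ 2 *
      ∑ p ∈ relevantPoints L α lam.toReal R,
        radialKernel α (α * lam.toReal * ‖(p : ℂ)‖) ‖z‖ := by
  classical
  rw [limitDensity, if_neg ht, if_neg hz]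
  set l := lam.toReal with hl
  have hlpos : 0 < l := ENNReal.toReal_pos hz ht
  have hαl : 0 < α * l := mul_pos h0 hlpos
  have h2 : 0 < 1 - α := by linarith
  have he : 2 / (1 - α) ≠ 0 := by positivity
  set S := relevantPoints L α l R with hS
  have hfs : ∑ᶠ p ∈ {p : ℂ | p ∈ L ∧ ‖p‖ ≤ ‖z‖ / (α * l)}, ‖p‖ ^ (2 / (1 - α)) =
      ∑ p ∈ S, if α * l * ‖(p : ℂ)‖ ≤ ‖z‖ then ‖(p : ℂ)‖ ^ (2 / (1 - α)) else 0 := by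
    rw [← Finset.sum_filter]
    have := Finset.sum_map (S.filter fun p : L => α * l * ‖(p : ℂ)‖ ≤ ‖z‖)
      (Function.Embedding.subtype fun x => x ∈ L) (fun p : ℂ => ‖p‖ ^ (2 / (1 - α)))
    simp only [Function.Embedding.subtype_apply] at this
    rw [← this]
    refine finsum_mem_eq_sum_of_inter_support_eq _ ?_
    ext p
    simp only [Set.mem_inter_iff, Set.mem_ofPred_eq, Function.mem_support, Finset.coe_map,
      Set.mem_image, Finset.mem_coe, Finset.mem_filter, Function.Embedding.subtype_apply]
    constructor
    · rintro ⟨⟨hp, hpz⟩, hne⟩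
      refine ⟨⟨⟨p, hp⟩, ⟨?_, ?_⟩, rfl⟩, hne⟩
      · rw [hS, mem_relevantPoints hαl]
        refine ⟨?_, ?_⟩
        · rintro h
          have : p = 0 := congrArg Subtype.val h
          rw [this, norm_zero, Real.zero_rpow he] at hne
          exact hne rfl
        · rw [le_div_iff₀ hαl] at hpz
          change α * l * ‖p‖ ≤ R
          linarith
      · rw [le_div_iff₀ hαl] at hpz
        change α * l * ‖p‖ ≤ ‖z‖
        linarith
    · rintro ⟨⟨q, ⟨hq, hqz⟩, rfl⟩, hne⟩
      refine ⟨⟨q.2, ?_⟩, hne⟩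
      rw [le_div_iff₀ hαl]
      linarith
  rw [hfs]
  have hcov := ZLattice.covolume_pos L volume
  generalize ZLattice.covolume L = V at *
  rw [Finset.mul_sum, Finset.mul_sum]
  refine Finset.sum_congr rfl fun p hp => ?_
  have hp' := (mem_relevantPoints hαl).1 hp
  have hpn : 0 < ‖(p : ℂ)‖ := norm_pos_iff.2 (by simpa using hp'.1)
  rw [radialKernel]
  split_ifs with h
  · have hz0 : 0 < ‖z‖ := (mul_pos hαl hpn).trans_le h
    rw [Real.div_rpow hz0.le hlpos.le, Real.rpow_neg hlpos.le, div_inv_eq_mul,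
      Real.mul_rpow hαl.le hpn.le, Real.mul_rpow h0.le hlpos.le]
    have e1 : l ^ ((4 - 2 * α) / (1 - α)) = l ^ 2 * l ^ (2 / (1 - α)) := by
      rw [← Real.rpow_natCast l 2, ← Real.rpow_add hlpos]
      congr 1
      push_cast
      field_simp
      ring
    rw [e1]
    have hV := hcov.ne'
    field_simp
  · simp

theorem exists_limitDensity_bound (h0 : 0 < α) (h1 : α < 1) (L : Submodule ℤ ℂ)
    [DiscreteTopology L] [IsZLattice ℝ L] (lam : ℝ≥0∞) (R : ℝ) :
    ∃ C : ℝ, ∀ z : ℂ, ‖z‖ ≤ R → limitDensity α L lam z ≤ C := by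
  by_cases ht : lam = ⊤
  · exact ⟨0, fun z _ => by rw [limitDensity, if_pos ht]⟩
  by_cases hz : lam = 0
  · exact ⟨_, fun z _ => by rw [limitDensity, if_neg ht, if_pos hz]⟩
  have hαl : 0 < α * lam.toReal := mul_pos h0 (ENNReal.toReal_pos hz ht)
  refine ⟨(ZLattice.covolume L)⁻¹ * lam.toReal ^ 2 * ∑ p ∈ relevantPoints L α lam.toReal R,
    1 / (1 - α) * (α * lam.toReal * ‖(p : ℂ)‖) ^ (2 / (1 - α)) *
      (α * lam.toReal * ‖(p : ℂ)‖) ^ (-((4 - 2 * α) / (1 - α))), fun z hzR => ?_⟩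
  rw [limitDensity_eq_sum_radialKernel h0 h1 L ht hz hzR]
  have hcov := ZLattice.covolume_pos L volume
  refine mul_le_mul_of_nonneg_left (Finset.sum_le_sum fun p hp => ?_) (by positivity)
  have hp' := (mem_relevantPoints hαl).1 hp
  exact radialKernel_le h1 (mul_pos hαl (norm_pos_iff.2 (by simpa using hp'.1)))

theorem limitDensity_nonneg (h0 : 0 < α) (h1 : α < 1) (L : Submodule ℤ ℂ)
    [DiscreteTopology L] [IsZLattice ℝ L] (lam : ℝ≥0∞) (z : ℂ) : 0 ≤ limitDensity α L lam z := by
  have hcov := ZLattice.covolume_pos L volume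
  by_cases ht : lam = ⊤
  · rw [limitDensity, if_pos ht]
  by_cases hz : lam = 0
  · rw [limitDensity, if_neg ht, if_pos hz]
    have : 0 < 2 - α := by linarith
    positivity
  have hαl : 0 < α * lam.toReal := mul_pos h0 (ENNReal.toReal_pos hz ht)
  rw [limitDensity_eq_sum_radialKernel h0 h1 L ht hz le_rfl]
  refine mul_nonneg (by positivity) (Finset.sum_nonneg fun p hp => ?_)
  have hp' := (mem_relevantPoints hαl).1 hp
  exact radialKernel_nonneg h1 (mul_pos hαl (norm_pos_iff.2 (by simpa using hp'.1)))

theorem measurable_limitDensity (h0 : 0 < α) (h1 : α < 1) (L : Submodule ℤ ℂ)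
    [DiscreteTopology L] [IsZLattice ℝ L] (lam : ℝ≥0∞) : Measurable (limitDensity α L lam) := by
  by_cases ht : lam = ⊤
  · have : limitDensity α L lam = fun _ => 0 := by
      ext z
      rw [limitDensity, if_pos ht]
    rw [this]
    exact measurable_const
  by_cases hz : lam = 0
  · have : limitDensity α L lam =
        fun _ => Real.pi / (α ^ 2 * (2 - α) * ZLattice.covolume L ^ 2) := by
      ext z
      rw [limitDensity, if_neg ht, if_pos hz]
    rw [this]
    exact measurable_const
  refine measurable_of_tendsto_metrizable (f := fun (n : ℕ) (z : ℂ) =>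
    (ZLattice.covolume L)⁻¹ * lam.toReal ^ 2 * ∑ p ∈ relevantPoints L α lam.toReal n,
        radialKernel α (α * lam.toReal * ‖(p : ℂ)‖) ‖z‖) (fun n => ?_) ?_
  · exact (Finset.measurable_sum _ fun p _ =>
      (measurable_radialKernel _ _).comp measurable_norm).const_mul _
  · refine tendsto_pi_nhds.2 fun z => tendsto_const_nhds.congr' ?_
    filter_upwards [eventually_ge_atTop ⌈‖z‖⌉₊] with n hn
    exact limitDensity_eq_sum_radialKernel h0 h1 L ht hz (Nat.ceil_le.1 hn)

theorem isFiniteMeasureOnCompacts_withDensity_limitDensity (h0 : 0 < α) (h1 : α < 1)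
    (L : Submodule ℤ ℂ) [DiscreteTopology L] [IsZLattice ℝ L] (lam : ℝ≥0∞) :
    IsFiniteMeasureOnCompacts
      (volume.withDensity fun z => ENNReal.ofReal (limitDensity α L lam z)) := by
  refine ⟨fun K hK => ?_⟩
  obtain ⟨R, hR⟩ := hK.isBounded.exists_norm_le
  obtain ⟨C, hC⟩ := exists_limitDensity_bound h0 h1 L lam R
  rw [withDensity_apply _ hK.measurableSet]
  calc ∫⁻ z in K, ENNReal.ofReal (limitDensity α L lam z)
      ≤ ∫⁻ _ in K, ENNReal.ofReal C :=
        setLIntegral_mono measurable_const fun z hz => ENNReal.ofReal_le_ofReal (hC z (hR z hz))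
    _ = ENNReal.ofReal C * volume K := by rw [setLIntegral_const]
    _ < ⊤ := ENNReal.mul_lt_top ENNReal.ofReal_lt_top hK.measure_lt_top

end Density

/-- The limit of the grid sums is the integral against the limit density. -/
theorem integral_levelLimit_eq {a b : ℕ} (ha : 0 < a) (hab : a < b) (L : Submodule ℤ ℂ)
    [DiscreteTopology L] [IsZLattice ℝ L] (lam : ℝ≥0∞) {f : ℂ → ℂ} (hf : Continuous f)
    (hfc : HasCompactSupport f) :
    (b : ℂ)⁻¹ * ((ZLattice.covolume L : ℂ)⁻¹ * ∫ w in Metric.ball (0 : ℂ) 1, ∑ k : Fin b,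
        levelLimit f ((a : ℝ) / b) L lam
          (Complex.exp (((((a : ℝ) / b) - 1 : ℝ) : ℂ) * logBranch k w))) =
      ∫ z, (limitDensity ((a : ℝ) / b) L lam z : ℂ) * f z := by
  have hbn : (b : ℂ) ≠ 0 := by exact_mod_cast (ha.trans hab).ne'
  have hb : (0 : ℝ) < b := by exact_mod_cast ha.trans hab
  have h0 : (0 : ℝ) < (a : ℝ) / b := div_pos (by exact_mod_cast ha) hb
  have h1 : (a : ℝ) / b < 1 := (div_lt_one hb).2 (by exact_mod_cast hab)
  have hball : MeasurableSet (Metric.ball (0 : ℂ) 1) := Metric.isOpen_ball.measurableSet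
  have hcov := ZLattice.covolume_pos L volume
  have hint := fun c hc => integral_ball_sum_levels (c := c) hab hf hfc hc
  have hne0 : ∀ᵐ w : ℂ, w ≠ 0 := by simp [ae_iff]
  generalize hα : (a : ℝ) / b = α at *
  by_cases ht : lam = ⊤
  · simp [levelLimit, limitDensity, ht]
  by_cases hz : lam = 0
  · have h2 : ∀ᵐ w : ℂ, w ∈ Metric.ball (0 : ℂ) 1 → (∑ k : Fin b, levelLimit f α L lam
        (Complex.exp (((α - 1 : ℝ) : ℂ) * logBranch k w))) =
        (((α ^ 2)⁻¹ * ‖w‖ ^ (2 - 2 * α) : ℝ) : ℂ) *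
          (b * (ZLattice.covolume L : ℂ)⁻¹ * ∫ v, f v) := by
      filter_upwards [hne0] with w hw _
      have hw' := norm_pos_iff.2 hw
      have h3 : ∀ k : Fin b, levelLimit f α L lam
          (Complex.exp (((α - 1 : ℝ) : ℂ) * logBranch k w)) =
          (ZLattice.covolume L : ℂ)⁻¹ *
            ((((α ^ 2)⁻¹ * ‖w‖ ^ (2 - 2 * α) : ℝ) : ℂ) * ∫ v, f v) := by
        intro k
        rw [levelLimit, if_neg ht, if_pos hz, integral_comp_complex_mul_left f
          (mul_ne_zero (by exact_mod_cast h0.ne') (Complex.exp_ne_zero _)), norm_mul,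
          norm_exp_mul_logBranch _ hw, Complex.norm_real, Real.norm_of_nonneg h0.le, mul_pow,
          mul_inv, ← Real.rpow_natCast (‖w‖ ^ (α - 1)) 2, ← Real.rpow_mul hw'.le,
          ← Real.rpow_neg hw'.le]
        congr 6
        push_cast
        ring
      rw [Finset.sum_congr rfl fun k _ => h3 k, Finset.sum_const, Finset.card_univ,
        Fintype.card_fin, nsmul_eq_mul]
      ring
    rw [setIntegral_congr_ae hball h2, integral_mul_const, integral_complex_ofReal,
      integral_const_mul, integral_ball_norm_rpow (by linarith)]
    simp_rw [limitDensity, if_neg ht, if_pos hz]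
    rw [integral_const_mul]
    have h4 : (2 : ℝ) - 2 * α + 2 = 2 * (2 - α) := by ring
    rw [h4]
    have h5 : (2 - (α : ℂ)) ≠ 0 := by
      have : (2 - α : ℝ) ≠ 0 := by linarith
      exact_mod_cast this
    have h6 : (α : ℂ) ≠ 0 := by exact_mod_cast h0.ne'
    generalize ZLattice.covolume L = V at *
    have h7 : (V : ℂ) ≠ 0 := by exact_mod_cast hcov.ne'
    push_cast
    field_simp
  · obtain ⟨R, hR, hfR⟩ := hfc.exists_pos_le_norm
    have hfR' : ∀ w, f w ≠ 0 → ‖w‖ ≤ R := fun w hw => le_of_lt (not_le.1 (mt (hfR w) hw))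
    have hdens : ∀ z : ℂ, (limitDensity α L lam z : ℂ) * f z =
        (ZLattice.covolume L : ℂ)⁻¹ * (lam.toReal : ℂ) ^ 2 *
          ∑ p ∈ relevantPoints L α lam.toReal R,
          (radialKernel α (α * lam.toReal * ‖(p : ℂ)‖) ‖z‖ : ℂ) * f z := by
      intro z
      by_cases hfz : f z = 0
      · simp [hfz]
      · rw [limitDensity_eq_sum_radialKernel h0 h1 L ht hz (hfR' z hfz), ← Finset.sum_mul]
        push_cast
        ring
    simp_rw [hdens]
    set l := lam.toReal with hl
    have hlpos : 0 < l := ENNReal.toReal_pos hz ht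
    have hαl : 0 < α * l := mul_pos h0 hlpos
    set S := relevantPoints L α l R with hS
    have h2 : ∀ᵐ w : ℂ, w ∈ Metric.ball (0 : ℂ) 1 → (∑ k : Fin b, levelLimit f α L lam
        (Complex.exp (((α - 1 : ℝ) : ℂ) * logBranch k w))) =
        (l : ℂ) ^ 2 * ∑ p ∈ S, ∑ k : Fin b,
          f ((α * l * p) * Complex.exp (((α - 1 : ℝ) : ℂ) * logBranch k w)) := by
      filter_upwards [hne0] with w hw hw1
      rw [mem_ball_zero_iff] at hw1
      rw [Finset.sum_comm, Finset.mul_sum]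
      refine Finset.sum_congr rfl fun k _ => ?_
      rw [levelLimit, if_neg ht, if_neg hz, tsum_eq_sum (s := S)]
      · congr 1
        refine Finset.sum_congr rfl fun p hp => ?_
        rw [if_neg ((mem_relevantPoints hαl).1 hp).1]
        congr 1
        ring
      · intro p hp
        split_ifs with hp0
        · rfl
        · by_contra hne
          refine hp ((mem_relevantPoints hαl).2 ⟨hp0, ?_⟩)
          have h3 := hfR' _ hne
          rw [norm_mul, norm_mul, norm_mul, norm_exp_mul_logBranch _ hw, Complex.norm_real,
            Complex.norm_real, Real.norm_of_nonneg h0.le, Real.norm_of_nonneg hlpos.le] at h3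
          have h4 : 1 ≤ ‖w‖ ^ (α - 1) :=
            Real.one_le_rpow_of_pos_of_le_one_of_nonpos (norm_pos_iff.2 hw) hw1.le (by linarith)
          refine le_trans ?_ h3
          calc α * l * ‖(p : ℂ)‖ = α * 1 * (l * ‖(p : ℂ)‖) := by ring
            _ ≤ _ := by gcongr
    have hcne : ∀ p ∈ S, (α * l * p : ℂ) ≠ 0 := by
      intro p hp
      have hp' := ((mem_relevantPoints hαl).1 hp).1
      have e1 : (α : ℂ) ≠ 0 := by exact_mod_cast h0.ne'
      have e2 : (l : ℂ) ≠ 0 := by exact_mod_cast hlpos.ne'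
      exact mul_ne_zero (mul_ne_zero e1 e2) (by simpa using hp')
    have hcnorm : ∀ p : L, ‖(α * l * p : ℂ)‖ = α * l * ‖(p : ℂ)‖ := by
      intro p
      rw [norm_mul, norm_mul, Complex.norm_real, Complex.norm_real, Real.norm_of_nonneg h0.le,
        Real.norm_of_nonneg hlpos.le]
    obtain ⟨M, hM⟩ := hf.bounded_above_of_compact_support hfc
    rw [setIntegral_congr_ae hball h2, integral_const_mul, integral_const_mul, integral_finsetSum,
      integral_finsetSum]
    · rw [Finset.sum_congr rfl fun p hp => hint _ (hcne p hp), ← Finset.mul_sum]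
      simp_rw [hcnorm]
      field_simp
    · intro p hp
      have hpos : 0 < α * l * ‖(p : ℂ)‖ := by
        rw [← hcnorm]
        exact norm_pos_iff.2 (hcne p hp)
      refine (hf.integrable_of_hasCompactSupport hfc).bdd_mul
        (c := 1 / (1 - α) * (α * l * ‖(p : ℂ)‖) ^ (2 / (1 - α)) *
          (α * l * ‖(p : ℂ)‖) ^ (-((4 - 2 * α) / (1 - α)))) ?_ ?_
      · exact (Complex.measurable_ofReal.comp
          ((measurable_radialKernel α _).comp measurable_norm)).aestronglyMeasurable
      · refine Eventually.of_forall fun z => ?_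
        rw [Complex.norm_real, Real.norm_of_nonneg (radialKernel_nonneg h1 hpos)]
        exact radialKernel_le h1 hpos
    · intro p _
      refine integrable_finsetSum _ fun k _ => ?_
      refine Measure.integrableOn_of_bounded (M := M) measure_ball_lt_top.ne ?_
        (Eventually.of_forall fun w => hM _)
      refine (hf.measurable.comp ?_).aestronglyMeasurable
      exact (Complex.measurable_exp.comp ((measurable_logBranch k).const_mul _)).const_mul _

/-! ### The empirical measures -/

theorem finite_logPairs (L : Submodule ℤ ℂ) [DiscreteTopology L] (z : ℂ) (N b : ℕ) :
    (logPairs {w : ℂ | ∃ p ∈ L, w = z + p} N 0 b).Finite := by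
  have hfin : ((fun x : L × ℕ => logBranch x.2 (z + x.1)) ''
      ({p : L | ‖z + (p : ℂ)‖ ≤ N} ×ˢ Set.Iio b)).Finite :=
    ((ZLattice.finite_norm_le L z N).prod (Set.finite_Iio b)).image _
  have hmem : ∀ r : ℂ, (∃ p ∈ L, Complex.exp r = z + p) → ‖Complex.exp r‖ ≤ N →
      -(2 * Real.pi * ((0 : ℕ) : ℝ)) ≤ r.im → r.im < 2 * Real.pi * b →
      r ∈ (fun x : L × ℕ => logBranch x.2 (z + x.1)) ''
        ({p : L | ‖z + (p : ℂ)‖ ≤ N} ×ˢ Set.Iio b) := by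
    rintro r ⟨p, hp, hr⟩ hN h1 h2
    rw [Nat.cast_zero, mul_zero, neg_zero] at h1
    obtain ⟨k, hk, hrk⟩ := exists_eq_logBranch h1 h2
    refine ⟨(⟨p, hp⟩, k), ⟨?_, hk⟩, ?_⟩
    · rw [hr] at hN
      exact hN
    · rw [hr] at hrk
      exact hrk.symm
  refine (hfin.prod hfin).subset ?_
  rintro ⟨r, s⟩ ⟨hr, hs, -, hrN, hsN, -, h1, h2, h3, h4⟩
  exact ⟨hmem r hr hrN h1 h2, hmem s hs hsN h3 h4⟩

theorem isFiniteMeasure_pairCorrelationMeasure (α : ℝ) (L : Submodule ℤ ℂ) [DiscreteTopology L]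
    (z : ℂ) (φ ψ : ℕ → ℝ) (N b : ℕ) :
    IsFiniteMeasure
      (pairCorrelationMeasure α {w : ℂ | ∃ p ∈ L, w = z + p} φ ψ N 0 b) := by
  have := (finite_logPairs L z N b).fintype
  refine ⟨?_⟩
  rw [pairCorrelationMeasure, Measure.smul_apply, Measure.sum_apply _ MeasurableSet.univ,
    smul_eq_mul, tsum_fintype]
  refine ENNReal.mul_lt_top ENNReal.ofReal_lt_top ?_
  simp

theorem integral_pairCorrelationMeasure (α : ℝ) (L : Submodule ℤ ℂ) [DiscreteTopology L]
    (z : ℂ) (φ ψ : ℕ → ℝ) (N b : ℕ) (hψ : 0 ≤ ψ N) (f : ℂ → ℂ) :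
    ∫ x, f x ∂(pairCorrelationMeasure α {w : ℂ | ∃ p ∈ L, w = z + p} φ ψ N 0 b) =
      ((1 / (b * ψ N) : ℝ) : ℂ) * ∑' x : logPairs {w : ℂ | ∃ p ∈ L, w = z + p} N 0 b,
        f (φ N * (Complex.exp (α * x.1.2) - Complex.exp (α * x.1.1))) := by
  have := (finite_logPairs L z N b).fintype
  rw [pairCorrelationMeasure, integral_smul_measure, Measure.sum_fintype,
    integral_finsetSum_measure fun _ _ => integrable_dirac (by finiteness), tsum_fintype,
    ENNReal.toReal_ofReal (by positivity), Complex.real_smul]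
  simp_rw [integral_dirac, Nat.cast_zero, zero_add]

theorem finite_support_levelTerm (f : ℂ → ℂ) (α φ : ℝ) (L : Submodule ℤ ℂ) [DiscreteTopology L]
    (z : ℂ) (N b : ℕ) :
    (Function.support fun y : L × (Fin b × L) =>
      levelTerm f α φ N b (z + y.1) y.2.1 y.2.2).Finite := by
  refine ((ZLattice.finite_norm_le L z N).prod
    ((Set.finite_univ (α := Fin b)).prod (ZLattice.finite_norm_le L 0 N))).subset ?_
  rintro ⟨m, k, p⟩ hne
  rw [Function.mem_support, levelTerm] at hne
  split_ifs at hne with hm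
  · rw [pairTerm] at hne
    split_ifs at hne with hp
    · refine ⟨hm.2, Set.mem_univ _, ?_⟩
      have h1 := hp.2.1
      rw [exp_logBranch _ hm.1] at h1
      change ‖(0 : ℂ) + p‖ ≤ N
      rw [zero_add]
      linarith [hm.2, norm_nonneg (z + (m : ℂ))]
    · exact absurd rfl hne
  · exact absurd rfl hne

theorem tsum_levelTerm_eq (f : ℂ → ℂ) (α φ : ℝ) (L : Submodule ℤ ℂ) [DiscreteTopology L]
    (z : ℂ) (N b : ℕ) :
    ∑' y : L × (Fin b × L), levelTerm f α φ N b (z + y.1) y.2.1 y.2.2 =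
      ∑' m : L, ∑ k : Fin b, ∑' p : L, levelTerm f α φ N b (z + m) k p := by
  have hs : Summable fun y : L × (Fin b × L) => levelTerm f α φ N b (z + y.1) y.2.1 y.2.2 :=
    summable_of_hasFiniteSupport (finite_support_levelTerm f α φ L z N b)
  rw [hs.tsum_prod]
  refine tsum_congr fun m => ?_
  rw [(hs.prod_factor m).tsum_prod, tsum_fintype]

theorem mainTheorem4 (a b : ℕ) (ha : 0 < a) (hab : a < b) (hcop : Nat.Coprime a b)
    (L : Submodule ℤ ℂ) [DiscreteTopology L] [IsZLattice ℝ L]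
    (Λ : Set ℂ) (hΛ : IsZGrid Λ L)
    (φ ψ : ℕ → ℝ)
    (hφpos : ∀ N : ℕ, 1 ≤ N → 0 < φ N)
    (hφ : Tendsto φ atTop atTop) (hψ : Tendsto ψ atTop atTop)
    (lam : ℝ≥0∞)
    (hlam : Tendsto (fun N : ℕ => ENNReal.ofReal (φ N / (N : ℝ) ^ (1 - (a : ℝ) / (b : ℝ))))
      atTop (𝓝 lam))
    (hψφ : ∀ N : ℕ, 1 ≤ N → ψ N = ((N : ℝ) ^ (2 - (a : ℝ) / (b : ℝ)) / φ N) ^ 2) :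
    VaguelyConverges
      (fun N => pairCorrelationMeasure ((a : ℝ) / (b : ℝ)) Λ φ ψ N 0 b)
      (volume.withDensity
        (fun z => ENNReal.ofReal (limitDensity ((a : ℝ) / (b : ℝ)) L lam z))) := by
  obtain ⟨z, rfl⟩ := hΛ
  have hb : (0 : ℝ) < b := by exact_mod_cast ha.trans hab
  have h0 : (0 : ℝ) < (a : ℝ) / b := div_pos (by exact_mod_cast ha) hb
  have h1 : (a : ℝ) / b < 1 := (div_lt_one hb).2 (by exact_mod_cast hab)
  refine ⟨fun N => ?_, isFiniteMeasureOnCompacts_withDensity_limitDensity h0 h1 L lam,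
    fun f hf hfc => ?_⟩
  · have := isFiniteMeasure_pairCorrelationMeasure ((a : ℝ) / b) L z φ ψ N b
    infer_instance
  have hmain := (tendsto_grid_sum h0 h1 L z hf hfc hφpos hφ hlam b).const_mul (b : ℂ)⁻¹
  rw [integral_levelLimit_eq ha hab L lam hf hfc] at hmain
  have hlimit : ∫ w, f w ∂(volume.withDensity
      fun w => ENNReal.ofReal (limitDensity ((a : ℝ) / b) L lam w)) =
      ∫ w, (limitDensity ((a : ℝ) / b) L lam w : ℂ) * f w := by
    rw [integral_withDensity_eq_integral_toReal_smul
      (measurable_limitDensity h0 h1 L lam).ennreal_ofReal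
      (Eventually.of_forall fun _ => ENNReal.ofReal_lt_top)]
    refine integral_congr_ae (Eventually.of_forall fun w => ?_)
    simp only
    rw [ENNReal.toReal_ofReal (limitDensity_nonneg h0 h1 L lam w), Complex.real_smul]
  rw [hlimit]
  refine hmain.congr' ?_
  obtain ⟨R, hR, hfR⟩ := hfc.exists_pos_le_norm
  obtain ⟨T, hT⟩ := exists_tsum_logPairs_eq h0 h1 L z hR.le (f := f)
    fun w hw => le_of_lt (not_le.1 (mt (hfR w) hw))
  filter_upwards [hφ.eventually_ge_atTop T, eventually_gt_atTop 0] with N hN1 hN2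
  have hN : (0 : ℝ) < N := by exact_mod_cast hN2
  have hφN := hφpos N hN2
  rw [integral_pairCorrelationMeasure _ L z φ ψ N b (by rw [hψφ N hN2]; positivity),
    hT (φ N) N b hN1 hN2, tsum_levelTerm_eq]
  simp_rw [← Finset.mul_sum]
  rw [tsum_mul_left, ← mul_assoc, ← mul_assoc]
  congr 1
  have hreal : (b : ℝ)⁻¹ * (N : ℝ)⁻¹ ^ 2 * (φ N / (N : ℝ) ^ (1 - (a : ℝ) / b)) ^ 2 =
      1 / (b * ψ N) := by
    have h2 : (N : ℝ) ^ (2 - (a : ℝ) / b) = N * (N : ℝ) ^ (1 - (a : ℝ) / b) := by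
      conv_rhs => rw [← Real.rpow_one_add' hN.le (by linarith)]
      congr 1
      ring
    have h3 := Real.rpow_pos_of_pos hN (1 - (a : ℝ) / b)
    rw [hψφ N hN2, h2]
    generalize (N : ℝ) ^ (1 - (a : ℝ) / b) = X at *
    field_simp
  rw [← hreal]
  push_cast
  ring
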